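/- Let $M$ be a compact connected smooth Riemannian manifold of dimension $n$ (without boundary), $p : X \to M$ its Riemannian universal covering, and $\Gamma$ the group of deck transformations of $p$, so that $M = X/\Gamma$. Let $d(\cdot,\cdot)$ be the Riemannian distance and $|\cdot|$ the Riemannian volume on $X$. Definitions. For $h>0$ and $D \subset X$ put $\partial_h D = \{x \in X : d(x,\partial D) \le h\}$ (empty if $\partial D = \emptyset$). A sequence $\{V_k\}$ of open sets is an *approximation* of a sequence $\{U_k\}$ of open sets if there is an $h>0$ with $U_k \,\Delta\, V_k \subset \partial_h U_k$ for all $k$. A *regular domain* is the non-empty interior of a connected compact subset of $X$ with smooth boundary; a *regular set* is a union of finitely many (at least one) regular domains with pairwise disjoint closures. A sequence $\{D_k\}$ of measurable subsets of $X$ with $0<|D_k|<\infty$ has *property (P)* if $$\lim_{k\to\infty} \frac{|\partial_d D_k|}{|D_k|} = 0 \quad\text{for all } d>0 .$$ A *connected polyhedral fundamental domain* is a connected set $\mathcal F \subset X$ that is a union of finitely many smoothly embedded closed $n$-simplices which overlap only at their boundaries, such that the translates $\gamma \mathcal F$, $\gamma\in\Gamma$, cover $X$ and have pairwise disjoint interiors.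 For $I \subset \Gamma$ let $\phi(I) = \operatorname{int}\big(\overline{\bigcup_{\gamma\in I}\gamma\mathcal F}\big)$. With $\mathcal F$ fixed, a sequence $\{D_k\}$ of regular sets is *admissible* if there is a monotone increasing sequence $\{I_k\}$ of non-empty finite subsets of $\Gamma$ with $$\lim_{k\to\infty}\frac{|I_k\,\Delta\, I_k\gamma|}{|I_k|}=0 \ \text{ for all } \gamma\in\Gamma, \qquad \sup_{k}\frac{|I_{k+1}I_k^{-1}|}{|I_{k+1}|}<\infty,$$ such that either $\{\phi(I_k)\}$ is an approximation of $\{D_k\}$ and $\{D_k\}$ has property (P), or $\{D_k\}$ is an approximation of $\{\phi(I_k)\}$. The (discrete) group $\Gamma$ is *amenable* if it has a left invariant finitely additive probability measure defined on all of its subsets. Proposition. 1. Let $\mathcal F$ be any connected polyhedral fundamental domain. Every monotone increasing sequence $\{D_k\}$ of regular sets in $X$ with property (P) has a subsequence $\{D_{k_j}\}$ that is admissible (with respect to $\mathcal F$). 2. There is a sequence of (not necessarily regular) subsets of $X$ with property (P) if and only if $\Gamma$ is amenable. Likewise, there is a monotone increasing sequence of regular subsets of $X$ with property (P) if and only if $\Gamma$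 is amenable. -/

import Mathlib

open Set Filter Topology MeasureTheory Manifold
open scoped ContDiff Pointwise symmDiff Bundle

section Groups

variable {G : Type*} [Group G]

/-- A discrete group is amenable if it carries a left invariant, finitely additive probability
measure that is defined on all of its subsets. -/
def IsAmenableGroup (G : Type*) [Group G] : Prop :=
  ∃ m : Set G → ℝ, (∀ s, 0 ≤ m s) ∧ m Set.univ = 1 ∧
    (∀ s t, Disjoint s t → m (s ∪ t) = m s + m t) ∧
    ∀ (g : G) (s : Set G), m (g • s) = m s

/-- Monotone increasing tempered Følner sequences of non-empty finite subsets of `G`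
(for right translations). -/
structure IsTemperedFolner (I : ℕ → Set G) : Prop where
  monotone : Monotone I
  nonempty : ∀ n, (I n).Nonempty
  finite : ∀ n, (I n).Finite
  folner : ∀ g : G,
    Tendsto (fun n => ((I n ∆ (I n * {g})).ncard : ℝ) / ((I n).ncard : ℝ)) atTop (𝓝 0)
  tempered : BddAbove (Set.range fun n =>
    ((I (n + 1) * (I n)⁻¹).ncard : ℝ) / ((I (n + 1)).ncard : ℝ))

end Groups

section Boundary

/-- The `h`-boundary `{x | d(x, ∂D) ≤ h}`. The extended distance to the empty set is `⊤`, so the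
`h`-boundary is empty if `∂D` is. -/
def hBoundary {X : Type*} [MetricSpace X] (h : ℝ) (D : Set X) : Set X :=
  {x | Metric.infEDist x (frontier D) ≤ ENNReal.ofReal h}

/-- The sequence `V` of open sets is an approximation of the sequence `U` of open sets. -/
def IsApproximation {X : Type*} [MetricSpace X] (V U : ℕ → Set X) : Prop :=
  (∀ n, IsOpen (V n)) ∧ (∀ n, IsOpen (U n)) ∧
    ∃ h : ℝ, 0 < h ∧ ∀ n, U n ∆ V n ⊆ hBoundary h (U n)

/-- Property (P) of a sequence of subsets of an `n`-dimensional Riemannian manifold with its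
Riemannian distance. The Riemannian volume is the Hausdorff measure of dimension `n`, normalized
so as to agree with Lebesgue measure on Euclidean space. The quotient of volumes is meaningful
only for measurable sets of positive finite volume. -/
structure HasPropertyP (n : ℕ) {X : Type*} [MetricSpace X] [MeasurableSpace X] [BorelSpace X]
    (D : ℕ → Set X) : Prop where
  measurableSet : ∀ k, MeasurableSet (D k)
  volume_ne_zero : ∀ k, (μHE[n] : Measure X) (D k) ≠ 0
  volume_ne_top : ∀ k, (μHE[n] : Measure X) (D k) ≠ ⊤
  tendsto : ∀ d : ℝ, 0 < d →
    Tendsto (fun k => (μHE[n] : Measure X) (hBoundary d (D k)) / (μHE[n] : Measure X) (D k))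
      atTop (𝓝 0)

end Boundary

section RegularSets

variable (n : ℕ) {X : Type*} [TopologicalSpace X] [ChartedSpace (EuclideanSpace ℝ (Fin n)) X]

/-- `K` has smooth boundary: near each of its boundary points, `K` is a sublevel set of a smooth
function with non-vanishing differential at that point. -/
def HasSmoothBoundary (K : Set X) : Prop :=
  ∀ x ∈ frontier K, ∃ (U : Set X) (f : X → ℝ), IsOpen U ∧ x ∈ U ∧
    ContMDiffOn (𝓡 n) 𝓘(ℝ, ℝ) ∞ f U ∧ mfderiv (𝓡 n) 𝓘(ℝ, ℝ) f x ≠ 0 ∧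
    ∀ y ∈ U, y ∈ K ↔ f y ≤ 0

/-- A regular domain is the non-empty interior of a connected compact set with smooth boundary. -/
def IsRegularDomain (D : Set X) : Prop :=
  D.Nonempty ∧ ∃ K : Set X, IsConnected K ∧ IsCompact K ∧ HasSmoothBoundary n K ∧ D = interior K

/-- A regular set is a finite union of (at least one) regular domains with pairwise disjoint
closures. -/
def IsRegularSet (D : Set X) : Prop :=
  ∃ (k : ℕ) (C : Fin k → Set X), 0 < k ∧ (∀ i, IsRegularDomain n (C i)) ∧
    (∀ i j, i ≠ j → Disjoint (closure (C i)) (closure (C j))) ∧ D = ⋃ i, C i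

/-- Smoothly embedded closed `n`-simplices in an `n`-dimensional manifold. -/
def IsSmoothSimplex (S : Set X) : Prop :=
  ∃ (v : Fin (n + 1) → EuclideanSpace ℝ (Fin n)) (f : EuclideanSpace ℝ (Fin n) → X)
    (U : Set (EuclideanSpace ℝ (Fin n))),
    AffineIndependent ℝ v ∧ IsOpen U ∧ convexHull ℝ (Set.range v) ⊆ U ∧
    ContMDiffOn (𝓡 n) (𝓡 n) ∞ f U ∧ Set.InjOn f (convexHull ℝ (Set.range v)) ∧
    (∀ x ∈ convexHull ℝ (Set.range v), Function.Injective (mfderiv (𝓡 n) (𝓡 n) f x)) ∧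
    S = f '' convexHull ℝ (Set.range v)

end RegularSets

section Coverings

/-- The group of deck transformations of `p : X → M`. -/
def deckGroup {X M : Type*} [TopologicalSpace X] (p : X → M) : Subgroup (X ≃ₜ X) where
  carrier := {γ | ∀ x, p (γ x) = p x}
  mul_mem' {a b} ha hb x := (ha (b x)).trans (hb x)
  one_mem' _ := rfl
  inv_mem' {a} ha x := by
    have h := ha (a⁻¹ x)
    rw [show a (a⁻¹ x) = x from a.apply_symm_apply x] at h
    exact h.symm

/-- Riemannian coverings: surjective smooth covering maps whose differentials are isometries. -/
structure IsRiemannianCovering (n : ℕ) {X M : Type*}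
    [TopologicalSpace X] [ChartedSpace (EuclideanSpace ℝ (Fin n)) X]
    [Bundle.RiemannianBundle (fun x : X => TangentSpace (𝓡 n) x)]
    [TopologicalSpace M] [ChartedSpace (EuclideanSpace ℝ (Fin n)) M]
    [Bundle.RiemannianBundle (fun x : M => TangentSpace (𝓡 n) x)]
    (p : X → M) : Prop where
  isCoveringMap : IsCoveringMap p
  surjective : Function.Surjective p
  contMDiff : ContMDiff (𝓡 n) (𝓡 n) ∞ p
  norm_mfderiv : ∀ (x : X) (v : TangentSpace (𝓡 n) x), ‖mfderiv (𝓡 n) (𝓡 n) p x v‖ = ‖v‖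

/-- Connected polyhedral fundamental domains for the deck transformation group of `p`: connected
finite unions of smooth simplices that overlap only at their boundaries, whose translates cover
`X` and have pairwise disjoint interiors. -/
structure IsPolyhedralFundamentalDomain (n : ℕ) {X M : Type*} [TopologicalSpace X]
    [ChartedSpace (EuclideanSpace ℝ (Fin n)) X] (p : X → M) (F : Set X) : Prop where
  isConnected : IsConnected F
  exists_simplices : ∃ (k : ℕ) (S : Fin k → Set X), (∀ i, IsSmoothSimplex n (S i)) ∧
    (∀ i j, i ≠ j → S i ∩ S j ⊆ frontier (S i) ∩ frontier (S j)) ∧ F = ⋃ i, S i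
  covers : ⋃ γ : deckGroup p, (γ : X ≃ₜ X) '' F = Set.univ
  disjoint_interior : ∀ γ γ' : deckGroup p, γ ≠ γ' →
    Disjoint (interior ((γ : X ≃ₜ X) '' F)) (interior ((γ' : X ≃ₜ X) '' F))

/-- The open set `φ(I)`, the interior of the closure of the union of the translates `γ F`, for
`γ ∈ I`. -/
def translatesInterior {X M : Type*} [TopologicalSpace X] (p : X → M) (F : Set X)
    (I : Set (deckGroup p)) : Set X :=
  interior (closure (⋃ γ ∈ I, ((γ : deckGroup p) : X ≃ₜ X) '' F))

/-- Admissible sequences of regular sets, with respect to a fundamental domain `F`. -/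
def IsAdmissibleSequence (n : ℕ) {X M : Type*} [MetricSpace X] [MeasurableSpace X] [BorelSpace X]
    [ChartedSpace (EuclideanSpace ℝ (Fin n)) X] (p : X → M) (F : Set X) (D : ℕ → Set X) : Prop :=
  (∀ k, IsRegularSet n (D k)) ∧
  ∃ I : ℕ → Set (deckGroup p), IsTemperedFolner I ∧
    ((IsApproximation (fun k => translatesInterior p F (I k)) D ∧ HasPropertyP n D) ∨
      IsApproximation D (fun k => translatesInterior p F (I k)))

end Coverings

/-! ### Amenable groups: means, Følner sets, tempered subsequences -/

section AmenableGroups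

variable {G : Type*} [Group G]

/-! The deck group acts on `X` isometrically, properly and cocompactly, so a compact set `K` whose
translates cover `X` turns volume into counting: each point lies in at most `N` translates, hence
the sum over the group of `μ (E ∩ g • K)` lies between `μ E` and `N * μ E`. Since `X` is a length
space, a curve from a point of `D` to a point outside `D` meets the frontier on the way. So whatever
changes under a displacement by a bounded amount is confined to a boundary neighbourhood of `D`, and
property (P) makes that negligible.

Property (P) thus makes the normalized weights `μ (D k ∩ g • K)` asymptotically right invariant, and
an ultralimit of them is an invariant mean (`isAmenableGroup_of_tendsto_measure_hBoundary`). The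
same counting shows that the translates of the fundamental domain `F` that meet `D k` are indexed by
a Følner sequence (`tendsto_ncard_symmDiff_div_of_tendsto_measure_hBoundary`). A subsequence is
tempered (`exists_isTemperedFolner_comp`), and the union of these translates differs from `D k` only
near its boundary; this gives admissibility through the first alternative of the definition.

Conversely, a mean excludes uniform doubling of finite sets by a Hall matching argument, and this
yields Følner sets containing any prescribed finite set. For such a set `I`, a regular set squeezed
between the union of the translates `g • K`, `g ∈ I`, and its 1-neighbourhood has small boundary
neighbourhoods (`IsAmenableGroup.exists_measure_hBoundary_le`); recursion makes the sequence
monotone. The regular set (`exists_isRegularSet_between`) is a superlevel set of a cut-off function,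
perturbed so that zero becomes a regular value; a Hausdorff dimension count takes the place of
Sard's theorem.

The Riemannian structure enters through three facts: almost shortest curves exist, charts are
locally bi-Lipschitz (so the volume is locally finite and positive on open sets), and deck
transformations are isometries. -/

theorem finitelyAdditive_biUnion {α ι : Type*} {m : Set α → ℝ}
    (hadd : ∀ s t, Disjoint s t → m (s ∪ t) = m s + m t) (S : Finset ι) (A : ι → Set α)
    (hA : (S : Set ι).PairwiseDisjoint A) : m (⋃ i ∈ S, A i) = ∑ i ∈ S, m (A i) := by
  classical
  have h0 : m ∅ = 0 := by simpa using hadd ∅ ∅ (by simp)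
  induction S using Finset.induction_on with
  | empty => simp [h0]
  | insert a S ha ih =>
    rw [Finset.set_biUnion_insert, hadd, Finset.sum_insert ha, ih]
    · exact hA.subset (by simp)
    · rw [Set.disjoint_iUnion₂_right]
      intro i hi
      exact hA (by simp) (by simp [hi]) (fun h => ha (h ▸ hi))

/-- A right invariant mean gives full mass to the range of an injective map of bounded right
displacement. -/
theorem mean_range_of_injective {m : Set G → ℝ} (huniv : m univ = 1)
    (hadd : ∀ s t, Disjoint s t → m (s ∪ t) = m s + m t)
    (hinv : ∀ (g : G) (s : Set G), m (s * {g}) = m s) (S : Finset G) (f : G → G)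
    (hf : Function.Injective f) (hS : ∀ x, x⁻¹ * f x ∈ S) : m (range f) = 1 := by
  have hr : range f = ⋃ s ∈ S, {x | f x = x * s} * {s} := by
    ext y
    simp only [mem_range, mem_iUnion, Set.mem_mul, mem_ofPred_eq, mem_singleton_iff, exists_prop]
    constructor
    · rintro ⟨x, rfl⟩
      exact ⟨_, hS x, x, by simp, _, rfl, by simp⟩
    · rintro ⟨s, -, x, hx, _, rfl, rfl⟩
      exact ⟨x, hx⟩
  have hu : univ = ⋃ s ∈ S, {x | f x = x * s} := by
    ext x
    simp only [mem_univ, mem_iUnion, mem_ofPred_eq, exists_prop, true_iff]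
    exact ⟨_, hS x, by simp⟩
  rw [hr, finitelyAdditive_biUnion hadd, ← huniv, hu, finitelyAdditive_biUnion hadd]
  · simp_rw [hinv]
  · intro s _ t _ hst
    rw [Function.onFun, Set.disjoint_left]
    intro x hx hx'
    have hx1 : f x = x * s := hx
    have hx2 : f x = x * t := hx'
    exact hst (mul_left_cancel (hx1.symm.trans hx2))
  · intro s _ t _ hst
    rw [Function.onFun, Set.disjoint_left]
    rintro _ ⟨x, hx, s', hs', rfl⟩ ⟨y, hy, t', ht', h⟩
    obtain rfl : s' = s := hs'
    obtain rfl : t' = t := ht'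
    simp only at h
    have hx' : f x = x * s' := hx
    have hy' : f y = y * t' := hy
    have hxy : x = y := hf (by rw [hx', hy', h])
    subst hxy
    exact hst (mul_left_cancel h).symm

/-- In an amenable group, right multiplication by a finite set cannot double the size of all
finite sets. -/
theorem IsAmenableGroup.exists_card_mul_lt_two_mul [DecidableEq G] (hG : IsAmenableGroup G)
    (S : Finset G) :
    ∃ A : Finset G, (A * S).card < 2 * A.card := by
  obtain ⟨m, hpos, huniv, hadd, hinv⟩ := hG
  by_contra! h
  -- If every finite set doubled, Hall's condition would hold for two copies of `G`, giving two
  -- injections of displacement in `S` with disjoint ranges. Each range would have mass 1, for a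
  -- total mass of 2.
  let t : G × Bool → Finset G := fun x => S.image (x.1 * ·)
  obtain ⟨f, hf, hft⟩ := (Finset.all_card_le_biUnion_card_iff_exists_injective t).1 (by
    intro B
    calc B.card ≤ ((B.image Prod.fst) ×ˢ (Finset.univ : Finset Bool)).card := by
          refine Finset.card_le_card fun x hx => ?_
          simp only [Finset.mem_product, Finset.mem_image, Finset.mem_univ, and_true]
          exact ⟨x, hx, rfl⟩
      _ = 2 * (B.image Prod.fst).card := by simp [mul_comm]
      _ ≤ ((B.image Prod.fst) * S).card := h _
      _ ≤ (B.biUnion t).card := by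
          refine Finset.card_le_card fun y hy => ?_
          obtain ⟨a, ha, s, hs, rfl⟩ := Finset.mem_mul.1 hy
          obtain ⟨b, hb, rfl⟩ := Finset.mem_image.1 ha
          exact Finset.mem_biUnion.2 ⟨b, hb, Finset.mem_image.2 ⟨s, hs, rfl⟩⟩)
  have key : ∀ b : Bool, m (range fun x => f (x, b))⁻¹ = 1 := by
    intro b
    -- Inversion turns the left invariant mean into a right invariant one.
    refine mean_range_of_injective (m := fun s => m s⁻¹) (by simpa using huniv) ?_ ?_ S _ ?_ ?_
    · intro s u hsu
      rw [Set.union_inv]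
      exact hadd _ _ (hsu.preimage Inv.inv)
    · intro g s
      rw [mul_inv_rev, Set.inv_singleton, Set.singleton_mul]
      exact hinv g⁻¹ s⁻¹
    · intro x y hxy
      simpa using hf hxy
    · intro x
      obtain ⟨s, hs, hx⟩ := Finset.mem_image.1 (hft (x, b))
      rw [← hx]
      simpa using hs
  set R := (range fun x => f (x, true))⁻¹
  set R' := (range fun x => f (x, false))⁻¹
  have hd : Disjoint R R' := by
    refine Disjoint.preimage Inv.inv ?_
    rw [Set.disjoint_left]
    rintro _ ⟨x, rfl⟩ ⟨y, hy⟩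
    simpa using hf hy
  have h1 := hadd _ _ hd
  have h2 := hadd (R ∪ R') (R ∪ R')ᶜ disjoint_compl_right
  rw [union_compl_self, huniv] at h2
  have h3 := hpos (R ∪ R')ᶜ
  rw [key, key] at h1
  linarith

/-- Growth by a factor `1 + ε` under `S` would iterate to growth by `(1 + ε) ^ k` under `S ^ k`,
which for large `k` contradicts the absence of doubling. -/
theorem IsAmenableGroup.exists_card_mul_lt [DecidableEq G] (hG : IsAmenableGroup G)
    (S : Finset G) {ε : ℝ} (hε : 0 < ε) :
    ∃ A : Finset G, A.Nonempty ∧ ((A * S).card : ℝ) < (1 + ε) * A.card := by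
  by_contra! h
  have h' : ∀ A : Finset G, (1 + ε) * A.card ≤ ((A * S).card : ℝ) := by
    intro A
    rcases A.eq_empty_or_nonempty with rfl | hA
    · simp
    · exact h A hA
  have hpow : ∀ (k : ℕ) (A : Finset G), (1 + ε) ^ k * A.card ≤ ((A * S ^ k).card : ℝ) := by
    intro k
    induction k with
    | zero => simp
    | succ k ih =>
      intro A
      calc (1 + ε) ^ (k + 1) * A.card = (1 + ε) * ((1 + ε) ^ k * A.card) := by ring
        _ ≤ (1 + ε) * ((A * S ^ k).card : ℝ) := by gcongr; exact ih A
        _ ≤ _ := by rw [pow_succ, ← mul_assoc]; exact h' _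
  obtain ⟨k, hk⟩ := pow_unbounded_of_one_lt (2 : ℝ) (show 1 < 1 + ε by linarith)
  obtain ⟨A, hA⟩ := hG.exists_card_mul_lt_two_mul (S ^ k)
  have h1 := hpow k A
  have h2 : ((A * S ^ k).card : ℝ) < 2 * A.card := by exact_mod_cast hA
  have h3 : (0 : ℝ) ≤ A.card := by positivity
  nlinarith

/-- Følner sets in an amenable group can be chosen to contain a given finite set. -/
theorem IsAmenableGroup.exists_finset_superset [DecidableEq G] (hG : IsAmenableGroup G)
    (B S : Finset G) {ε : ℝ} (hε : 0 < ε) :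
    ∃ A : Finset G, A.Nonempty ∧ B ⊆ A ∧ (((A * S) \ A).card : ℝ) ≤ ε * A.card := by
  rcases finite_or_infinite G with hfin | hinf
  · have := Fintype.ofFinite G
    refine ⟨Finset.univ, Finset.univ_nonempty, by simp, ?_⟩
    rw [Finset.sdiff_eq_empty_iff_subset.2 (Finset.subset_univ _)]
    simp only [Finset.card_empty, Nat.cast_zero]
    positivity
  -- Enlarging the multiplier by `N` extra elements `T` forces `A` itself to be large, so that
  -- adjoining `B` costs at most another `ε / 2`. The element 1 in the multiplier makes the product
  -- contain `A`.
  obtain ⟨N, hN⟩ := exists_nat_gt ((1 + ε / 2) * (2 * (B.card * S.card) / ε))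
  obtain ⟨T, hT⟩ := Infinite.exists_subset_card_eq G N
  obtain ⟨A, hA, hAc⟩ := hG.exists_card_mul_lt (insert 1 (S ∪ T)) (half_pos hε)
  have h1 : (N : ℝ) ≤ (A * insert 1 (S ∪ T)).card := by
    rw [← hT]
    norm_cast
    calc T.card ≤ (insert 1 (S ∪ T)).card := Finset.card_le_card (by grind)
      _ ≤ _ := Finset.card_le_card_mul_left hA
  have hlarge : (2 * (B.card * S.card) / ε : ℝ) ≤ A.card := by
    have : (1 + ε / 2) * (2 * (B.card * S.card) / ε) ≤ (1 + ε / 2) * A.card := by linarith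
    exact le_of_mul_le_mul_left this (by positivity)
  rw [div_le_iff₀ hε] at hlarge
  have hsub : A ⊆ A * insert 1 (S ∪ T) := fun x hx =>
    Finset.mem_mul.2 ⟨x, hx, 1, by simp, by simp⟩
  have h2 : (((A * S) \ A).card : ℝ) ≤ ε / 2 * A.card := by
    have : ((A * S) \ A).card + A.card ≤ (A * insert 1 (S ∪ T)).card := by
      rw [← Finset.card_sdiff_add_card_eq_card hsub]
      gcongr
      grind
    have : (((A * S) \ A).card : ℝ) + A.card ≤ (A * insert 1 (S ∪ T)).card := by exact_mod_cast this
    linarith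
  refine ⟨B ∪ A, hA.mono Finset.subset_union_right, Finset.subset_union_left, ?_⟩
  have h3 : (((B ∪ A) * S) \ (B ∪ A)).card ≤ B.card * S.card + ((A * S) \ A).card := by
    calc (((B ∪ A) * S) \ (B ∪ A)).card ≤ (B * S ∪ ((A * S) \ A)).card := by
          refine Finset.card_le_card fun x hx => ?_
          rw [Finset.union_mul] at hx
          grind
      _ ≤ (B * S).card + ((A * S) \ A).card := Finset.card_union_le _ _
      _ ≤ _ := by gcongr; exact Finset.card_mul_le
  have h4 : ((((B ∪ A) * S) \ (B ∪ A)).card : ℝ) ≤ B.card * S.card + ((A * S) \ A).card := by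
    exact_mod_cast h3
  have h5 : (A.card : ℝ) ≤ (B ∪ A).card := by
    exact_mod_cast Finset.card_le_card Finset.subset_union_right
  nlinarith

/-- Reiter's criterion: asymptotically right invariant probability vectors yield an invariant
mean. -/
theorem isAmenableGroup_of_tendsto_tsum {a : ℕ → G → ℝ} (hpos : ∀ k g, 0 ≤ a k g)
    (hsum : ∀ k, HasSum (a k) 1)
    (hinv : ∀ g : G, Tendsto (fun k => ∑' x, |a k (x * g) - a k x|) atTop (𝓝 0)) :
    IsAmenableGroup G := by
  -- The weights are almost right invariant; summing over `s⁻¹` makes the limit left invariant.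
  let M : ℕ → Set G → ℝ := fun k s => ∑' x, (s⁻¹).indicator (a k) x
  have hs : ∀ k (s : Set G), Summable (s.indicator (a k)) := fun k s => (hsum k).summable.indicator s
  have hM0 : ∀ k s, 0 ≤ M k s := fun k s =>
    tsum_nonneg fun x => Set.indicator_nonneg (fun x _ => hpos k x) x
  have hM1 : ∀ k s, M k s ≤ 1 := by
    intro k s
    rw [← (hsum k).tsum_eq]
    exact (hs k _).tsum_le_tsum (fun x => Set.indicator_le_self' (fun x _ => hpos k x) x)
      (hsum k).summable
  have hlim : ∀ s, ∃ l, Tendsto (fun k => M k s) (hyperfilter ℕ : Filter ℕ) (𝓝 l) := by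
    intro s
    obtain ⟨l, -, hl⟩ := (isCompact_Icc (a := (0 : ℝ)) (b := 1)).ultrafilter_le_nhds
      ((hyperfilter ℕ).map fun k => M k s)
      (by
        rw [le_principal_iff]
        exact Filter.mem_map.2 (Filter.univ_mem' fun k => ⟨hM0 k s, hM1 k s⟩))
    exact ⟨l, hl⟩
  choose m hm using hlim
  refine ⟨m, fun s => ge_of_tendsto' (hm s) fun k => hM0 k s, ?_, ?_, ?_⟩
  · refine tendsto_nhds_unique (hm univ) (tendsto_const_nhds.congr fun k => ?_)
    simp [M, (hsum k).tsum_eq]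
  · intro s t hst
    refine tendsto_nhds_unique (hm (s ∪ t)) (((hm s).add (hm t)).congr fun k => ?_)
    simp only [M]
    rw [Set.union_inv, Set.indicator_union_of_disjoint (show Disjoint s⁻¹ t⁻¹ from hst.preimage Inv.inv),
      (hs k _).tsum_add (hs k _)]
  · intro g s
    have hd : Tendsto (fun k => M k (g • s) - M k s) (hyperfilter ℕ : Filter ℕ) (𝓝 0) := by
      refine squeeze_zero_norm (fun k => ?_)
        ((hinv g⁻¹).mono_left (Nat.hyperfilter_le_atTop))
      have h1 : M k (g • s) = ∑' x, (s⁻¹).indicator (fun x => a k (x * g⁻¹)) x := by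
        simp only [M]
        rw [← (Equiv.mulRight g⁻¹).tsum_eq]
        refine tsum_congr fun x => ?_
        have hx : x * g⁻¹ ∈ (g • s)⁻¹ ↔ x ∈ s⁻¹ := by
          rw [Set.mem_inv, Set.mem_inv, Set.mem_smul_set_iff_inv_smul_mem]
          simp
        rw [Equiv.coe_mulRight]
        by_cases h : x ∈ s⁻¹
        · rw [Set.indicator_of_mem h, Set.indicator_of_mem (hx.2 h)]
        · rw [Set.indicator_of_notMem h, Set.indicator_of_notMem (fun h' => h (hx.1 h'))]
      have hsg : Summable fun x => a k (x * g⁻¹) :=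
        (Equiv.mulRight g⁻¹).summable_iff.2 (hsum k).summable
      have habs : Summable fun x => |a k (x * g⁻¹) - a k x| := (hsg.sub (hsum k).summable).abs
      rw [h1, ← (hsg.indicator _).tsum_sub (hs k _)]
      have habs' : Summable fun x => ‖(s⁻¹).indicator (fun x => a k (x * g⁻¹)) x
          - (s⁻¹).indicator (a k) x‖ := ((hsg.indicator _).sub (hs k _)).norm
      refine (norm_tsum_le_tsum_norm habs').trans (habs'.tsum_le_tsum (fun x => ?_) habs)
      by_cases hx : x ∈ s⁻¹
      · simp [Set.indicator_of_mem hx]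
      · simp only [Set.indicator_of_notMem hx, sub_zero, norm_zero]
        positivity
    have := tendsto_nhds_unique hd ((hm (g • s)).sub (hm s))
    linarith

/-- A monotone Følner sequence has a tempered subsequence. -/
theorem exists_isTemperedFolner_comp {I : ℕ → Set G} (hmono : Monotone I)
    (hne : ∀ n, (I n).Nonempty) (hfin : ∀ n, (I n).Finite)
    (hfol : ∀ g : G, Tendsto (fun n => ((I n ∆ (I n * {g})).ncard : ℝ) / ((I n).ncard : ℝ))
      atTop (𝓝 0)) :
    ∃ j : ℕ → ℕ, StrictMono j ∧ IsTemperedFolner (I ∘ j) := by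
  have hcard : ∀ n, (0 : ℝ) < (I n).ncard := fun n => by
    exact_mod_cast (Set.ncard_pos (hfin n)).2 (hne n)
  -- For fixed `m`, multiplication by the finite set `(I m)⁻¹` adds only elements of finitely many
  -- sets `I n ∆ (I n * {g})`, in total at most `(I n).ncard` elements once `n` is large.
  have step : ∀ m, ∃ n, m < n ∧ ((I n * (I m)⁻¹).ncard : ℝ) / (I n).ncard ≤ 2 := by
    intro m
    have hTfin : (I m)⁻¹.Finite := (hfin m).inv
    have ht : Tendsto (fun n => ∑ g ∈ hTfin.toFinset,
        ((I n ∆ (I n * {g})).ncard : ℝ) / ((I n).ncard : ℝ)) atTop (𝓝 0) := by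
      simpa using tendsto_finsetSum hTfin.toFinset fun g _ => hfol g
    obtain ⟨n, hn, hmn⟩ := ((ht.eventually_le_const one_pos).and (eventually_gt_atTop m)).exists
    refine ⟨n, hmn, ?_⟩
    rw [div_le_iff₀ (hcard n)]
    rw [← Finset.sum_div, div_le_iff₀ (hcard n)] at hn
    have h1 : (I n * (I m)⁻¹).ncard ≤
        (I n).ncard + ∑ g ∈ hTfin.toFinset, (I n ∆ (I n * {g})).ncard := by
      have hsub : I n * (I m)⁻¹ ⊆ I n ∪ ⋃ g ∈ hTfin.toFinset, (I n ∆ (I n * {g})) := by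
        rintro _ ⟨x, hx, g, hg, rfl⟩
        by_cases hxg : x * g ∈ I n
        · exact Or.inl hxg
        · refine Or.inr ?_
          simp only [mem_iUnion, exists_prop]
          exact ⟨g, by simpa using hg, Or.inr ⟨Set.mul_mem_mul hx rfl, hxg⟩⟩
      have hf : ∀ g, (I n ∆ (I n * {g})).Finite := fun g =>
        ((hfin n).union ((hfin n).mul (finite_singleton g))).subset symmDiff_subset_union
      have hfu : (⋃ g ∈ hTfin.toFinset, (I n ∆ (I n * {g}))).Finite :=
        Set.Finite.biUnion (Finset.finite_toSet _) fun g _ => hf g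
      refine (Set.ncard_le_ncard hsub ((hfin n).union hfu)).trans
        ((Set.ncard_union_le _ _).trans ?_)
      gcongr
      exact Finset.set_ncard_biUnion_le _ _
    have h2 : ((I n * (I m)⁻¹).ncard : ℝ) ≤
        (I n).ncard + ∑ g ∈ hTfin.toFinset, ((I n ∆ (I n * {g})).ncard : ℝ) := by
      exact_mod_cast h1
    linarith
  choose f hf1 hf2 using step
  let j : ℕ → ℕ := fun k => f^[k] 0
  have hj : ∀ k, j (k + 1) = f (j k) := fun k => Function.iterate_succ_apply' f k 0
  have hjm : StrictMono j := strictMono_nat_of_lt_succ fun k => by rw [hj]; exact hf1 _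
  refine ⟨j, hjm, hmono.comp hjm.monotone, fun n => hne _, fun n => hfin _,
    fun g => (hfol g).comp hjm.tendsto_atTop, 2, ?_⟩
  rintro _ ⟨k, rfl⟩
  simp only [Function.comp_apply, hj]
  exact hf2 _

end AmenableGroups

/-! ### Perturbing a smooth function to make zero a regular value -/

section RegularPerturbation

theorem dimH_image_le_finrank_of_contDiffOn {V W : Type*} [NormedAddCommGroup V] [NormedSpace ℝ V]
    [FiniteDimensional ℝ V] [NormedAddCommGroup W] [NormedSpace ℝ W] {f : V → W} {s : Set V}
    (hs : IsOpen s) (hf : ContDiffOn ℝ 1 f s) : dimH (f '' s) ≤ Module.finrank ℝ V := by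
  rw [← Real.dimH_univ_eq_finrank V]
  refine (dimH_image_le_of_locally_lipschitzOn fun x hx => ?_).trans (dimH_mono (subset_univ s))
  obtain ⟨K, t, ht, hK⟩ := (hf.contDiffAt (hs.mem_nhds hx)).exists_lipschitzOnWith
  exact ⟨K, t, mem_nhdsWithin_of_mem_nhds ht, hK⟩

theorem finrank_dual_prod (E : Type*) [NormedAddCommGroup E] [NormedSpace ℝ E]
    [FiniteDimensional ℝ E] :
    Module.finrank ℝ ((E →L[ℝ] ℝ) × ℝ) = Module.finrank ℝ E + 1 := by
  rw [Module.finrank_prod, Module.finrank_self,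
    ← (LinearMap.toContinuousLinearMap (𝕜 := ℝ) (E := E) (F' := ℝ)).finrank_eq,
    Module.finrank_linearMap, Module.finrank_self, mul_one]

/-- Affine perturbations of a function for which zero is a critical value form a small set: the
parameters are determined by the critical point. -/
theorem dimH_setOf_critical_zero_lt {E ι : Type*} [NormedAddCommGroup E] [NormedSpace ℝ E]
    [FiniteDimensional ℝ E] [Fintype ι] (i : ι) {W : Set E} (hW : IsOpen W) {v : E → ℝ}
    {α : ι → E → ℝ} {b : ι → E → E} (hv : ContDiffOn ℝ 2 v W) (hα : ∀ j, ContDiffOn ℝ 2 (α j) W)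
    (hb : ∀ j, ContDiffOn ℝ 2 (b j) W) (hαi : ∀ y ∈ W, α i y = 1) (hbi : ∀ y ∈ W, b i y = y) :
    dimH {q : ι → (E →L[ℝ] ℝ) × ℝ | ∃ y ∈ W,
      v y - ∑ j, ((q j).1 (b j y) + (q j).2 * α j y) = 0 ∧
      fderiv ℝ (fun y => v y - ∑ j, ((q j).1 (b j y) + (q j).2 * α j y)) y = 0} ≤
    ((Fintype.card ι - 1) * (Module.finrank ℝ E + 1) + Module.finrank ℝ E : ℕ) := by
  classical
  let P := (E →L[ℝ] ℝ) × ℝ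
  let J := {j : ι // j ≠ i}
  let g1 : (J → P) × E → (E →L[ℝ] ℝ) := fun z => fderiv ℝ v z.2 -
    ∑ j : J, ((z.1 j).1 ∘L fderiv ℝ (b j) z.2 + (z.1 j).2 • fderiv ℝ (α j) z.2)
  let g2 : (J → P) × E → ℝ := fun z => v z.2 -
    ∑ j : J, ((z.1 j).1 (b j z.2) + (z.1 j).2 * α j z.2) - g1 z z.2
  -- On `W` the `i`-th perturbation is honestly affine in `y`. At a critical zero the vanishing
  -- derivative determines its linear part `g1` and the vanishing value its constant part `g2`. So
  -- `Φ` recovers `q` from its other components and `y`, one dimension fewer than the parameter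
  -- space.
  let Φ : (J → P) × E → (ι → P) := fun z j => if h : j ≠ i then z.1 ⟨j, h⟩ else (g1 z, g2 z)
  let s : Set ((J → P) × E) := univ ×ˢ W
  have hs : IsOpen s := isOpen_univ.prod hW
  have hsnd : MapsTo (Prod.snd : (J → P) × E → E) s W := fun z hz => hz.2
  have hsndc : ContDiffOn ℝ 1 (Prod.snd : (J → P) × E → E) s := contDiff_snd.contDiffOn
  have hfst : ∀ j : J, ContDiff ℝ 1 (fun z : (J → P) × E => z.1 j) := fun j =>
    (contDiff_apply ℝ P j).comp contDiff_fst
  have h12 : (1 : WithTop ℕ∞) + 1 ≤ 2 := by norm_num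
  have h12' : (1 : WithTop ℕ∞) ≤ 2 := by norm_num
  have hg1 : ContDiffOn ℝ 1 g1 s := by
    refine ((hv.fderiv_of_isOpen hW h12).comp hsndc hsnd).sub (ContDiffOn.sum fun j _ => ?_)
    refine ContDiffOn.add ?_ ?_
    · exact (hfst j).fst.contDiffOn.clm_comp (((hb j).fderiv_of_isOpen hW h12).comp hsndc hsnd)
    · exact (hfst j).snd.contDiffOn.smul (((hα j).fderiv_of_isOpen hW h12).comp hsndc hsnd)
  have hg2 : ContDiffOn ℝ 1 g2 s := by
    refine (((hv.of_le h12').comp hsndc hsnd).sub (ContDiffOn.sum fun j _ => ?_)).sub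
      (hg1.clm_apply contDiff_snd.contDiffOn)
    refine ContDiffOn.add ?_ ?_
    · exact (hfst j).fst.contDiffOn.clm_apply (((hb j).of_le h12').comp hsndc hsnd)
    · exact (hfst j).snd.contDiffOn.mul (((hα j).of_le h12').comp hsndc hsnd)
  have hΦ : ContDiffOn ℝ 1 Φ s := by
    refine contDiffOn_pi.2 fun j => ?_
    by_cases h : j ≠ i
    · simp only [Φ, h, not_false_eq_true, dif_pos, ne_eq]
      exact (hfst ⟨j, h⟩).contDiffOn
    · simp only [Φ, h, dif_neg, not_false_eq_true]
      exact hg1.prodMk hg2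
  have hdim := dimH_image_le_finrank_of_contDiffOn hs hΦ
  have hfin : Module.finrank ℝ ((J → P) × E) =
      (Fintype.card ι - 1) * (Module.finrank ℝ E + 1) + Module.finrank ℝ E := by
    rw [Module.finrank_prod, Module.finrank_pi_fintype]
    simp only [P, J, finrank_dual_prod, Finset.sum_const, Finset.card_univ, smul_eq_mul,
      Fintype.card_subtype_compl, Fintype.card_unique]
  rw [← hfin]
  refine le_trans (dimH_mono ?_) hdim
  rintro q ⟨y, hy, hq0, hq1⟩
  refine ⟨(fun j => q j, y), ⟨mem_univ _, hy⟩, ?_⟩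
  have hsplit : ∀ y' ∈ W, v y' - ∑ j, ((q j).1 (b j y') + (q j).2 * α j y') =
      v y' - ∑ j : J, ((q j).1 (b j y') + (q j).2 * α j y') - ((q i).1 y' + (q i).2) := by
    intro y' hy'
    rw [← Fintype.sum_subtype_add_sum_subtype (fun j => j ≠ i)]
    have : ∑ j : {j // ¬ (j ≠ i)}, ((q j).1 (b j y') + (q j).2 * α j y') =
        (q i).1 y' + (q i).2 := by
      rw [Fintype.sum_eq_single (⟨i, by simp⟩ : {j // ¬ (j ≠ i)})]
      · simp [hαi y' hy', hbi y' hy']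
      · rintro ⟨j, hj⟩ hne
        exact absurd (Subtype.ext (by simpa using hj)) hne
    rw [this]
    ring
  have hd : HasFDerivAt (fun y => v y - ∑ j : J, ((q j).1 (b j y) + (q j).2 * α j y) -
      ((q i).1 y + (q i).2)) (g1 (fun j => q j, y) - (q i).1) y := by
    have hvd : HasFDerivAt v (fderiv ℝ v y) y :=
      ((hv.contDiffAt (hW.mem_nhds hy)).differentiableAt two_ne_zero).hasFDerivAt
    have hbd : ∀ j, HasFDerivAt (b j) (fderiv ℝ (b j) y) y := fun j =>
      (((hb j).contDiffAt (hW.mem_nhds hy)).differentiableAt two_ne_zero).hasFDerivAt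
    have hαd : ∀ j, HasFDerivAt (α j) (fderiv ℝ (α j) y) y := fun j =>
      (((hα j).contDiffAt (hW.mem_nhds hy)).differentiableAt two_ne_zero).hasFDerivAt
    refine (hvd.sub (HasFDerivAt.fun_sum fun j _ => ?_)).sub ((q i).1.hasFDerivAt.add_const _)
    exact ((q j).1.hasFDerivAt.comp y (hbd j)).add ((hαd j).const_mul _)
  have hd' := hd.congr_of_eventuallyEq (f₁ := fun y => v y - ∑ j, ((q j).1 (b j y) + (q j).2 * α j y))
    (by filter_upwards [hW.mem_nhds hy] with y' hy' using hsplit y' hy')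
  rw [hd'.fderiv, sub_eq_zero] at hq1
  rw [hsplit y hy] at hq0
  ext1 j
  by_cases h : j ≠ i
  · simp only [Φ, h, not_false_eq_true, dif_pos, ne_eq]
  · simp only [Φ, h, dif_neg, not_false_eq_true]
    obtain rfl : j = i := by simpa using h
    refine Prod.ext hq1 ?_
    simp only [g2]
    rw [hq1]
    linarith

variable {n : ℕ} {X : Type*} [TopologicalSpace X] [T2Space X]
  [ChartedSpace (EuclideanSpace ℝ (Fin n)) X] [IsManifold (𝓡 n) ∞ X]

/-- Smooth functions can be perturbed so that zero becomes a regular value near a given compact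
set. -/
theorem exists_contMDiff_regular_zero {Q : Set X} (hQ : IsCompact Q) {u₀ : X → ℝ}
    (hu₀ : ContMDiff (𝓡 n) 𝓘(ℝ, ℝ) ∞ u₀) {ε : ℝ} (hε : 0 < ε) :
    ∃ u : X → ℝ, ContMDiff (𝓡 n) 𝓘(ℝ, ℝ) ∞ u ∧ (∀ x, |u x - u₀ x| < ε) ∧
      ∀ x ∈ Q, u x = 0 → mfderiv (𝓡 n) 𝓘(ℝ, ℝ) u x ≠ 0 := by
  classical
  let E := EuclideanSpace ℝ (Fin n)
  let ρ : ∀ x : X, SmoothBumpFunction (𝓡 n) x := fun x => Classical.arbitrary _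
  let O : X → Set X := fun x => interior {y | ρ x y = 1}
  have hO : ∀ x, IsOpen (O x) := fun x => isOpen_interior
  have hxO : ∀ x, x ∈ O x := fun x => mem_interior_iff_mem_nhds.2 (ρ x).eventuallyEq_one
  have hO1 : ∀ x, ∀ y ∈ O x, ρ x y = 1 := fun x y hy =>
    (interior_subset hy : y ∈ {y | ρ x y = 1})
  have hOs : ∀ x, O x ⊆ (extChartAt (𝓡 n) x).source := by
    intro x y hy
    rw [extChartAt_source]
    refine (ρ x).support_subset_source ?_
    simp [Function.mem_support, hO1 x y hy]
  obtain ⟨T, -, hT⟩ := hQ.elim_nhds_subcover O fun x _ => (hO x).mem_nhds (hxO x)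
  let ι := T
  rcases isEmpty_or_nonempty ι with hι | hι
  · refine ⟨u₀, hu₀, fun x => by simpa using hε, fun x hx => ?_⟩
    obtain ⟨i, hi, -⟩ := mem_iUnion₂.1 (hT hx)
    exact (hι.false ⟨i, hi⟩).elim
  -- Cut-off chart coordinates: `β i` is the chart itself on `O i`, so affine functions in each
  -- chart extend to smooth functions on all of `X`.
  let β : ι → X → E := fun i x => ρ i x • extChartAt (𝓡 n) (i : X) x
  have hβ : ∀ i, ContMDiff (𝓡 n) 𝓘(ℝ, E) ∞ (β i) := fun i =>
    (ρ i).contMDiff_smul (contMDiffOn_extChartAt)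
  have hρ : ∀ i : ι, ContMDiff (𝓡 n) 𝓘(ℝ, ℝ) ∞ (ρ i) := fun i => (ρ i).contMDiff
  have hβb : ∀ i, ∃ C, ∀ x, ‖β i x‖ ≤ C := by
    intro i
    refine (hβ i).continuous.bounded_above_of_compact_support ?_
    exact (ρ i).hasCompactSupport.smul_right
  choose C hC using hβb
  let P := (E →L[ℝ] ℝ) × ℝ
  let pert : (ι → P) → X → ℝ := fun q x => ∑ i, ((q i).1 (β i x) + (q i).2 * ρ i x)
  have hpert : ∀ q, ContMDiff (𝓡 n) 𝓘(ℝ, ℝ) ∞ (pert q) := by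
    intro q
    refine ContMDiff.sum fun i _ => ContMDiff.add ?_ ?_
    · exact (q i).1.contMDiff.comp (hβ i)
    · exact contMDiff_const.mul (hρ i)
  have hu : ∀ q, ContMDiff (𝓡 n) 𝓘(ℝ, ℝ) ∞ (fun x => u₀ x - pert q x) := fun q =>
    hu₀.sub (hpert q)
  let bad : ι → Set (ι → P) := fun i => {q | ∃ x ∈ O i, u₀ x - pert q x = 0 ∧
    mfderiv (𝓡 n) 𝓘(ℝ, ℝ) (fun x => u₀ x - pert q x) x = 0}
  have hbad : ∀ i, dimH (bad i) ≤ ((Fintype.card ι - 1) * (n + 1) + n : ℕ) := by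
    intro i
    let φ := extChartAt (𝓡 n) (i : X)
    let W : Set E := φ.target ∩ φ.symm ⁻¹' (O i)
    have hWo : IsOpen W :=
      (continuousOn_extChartAt_symm (i : X)).isOpen_inter_preimage (isOpen_extChartAt_target _) (hO i)
    have hsymm : ContMDiffOn 𝓘(ℝ, E) (𝓡 n) ∞ φ.symm W :=
      (contMDiffOn_extChartAt_symm (i : X)).mono inter_subset_left
    have h2 : (2 : WithTop ℕ∞) ≤ ∞ := ENat.LEInfty.out
    have hcomp : ∀ {F : Type} [NormedAddCommGroup F] [NormedSpace ℝ F] {f : X → F},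
        ContMDiff (𝓡 n) 𝓘(ℝ, F) ∞ f → ContDiffOn ℝ 2 (f ∘ φ.symm) W := fun hf =>
      (contMDiffOn_iff_contDiffOn.1 (hf.comp_contMDiffOn hsymm)).of_le h2
    have key := dimH_setOf_critical_zero_lt i hWo (hcomp hu₀) (fun j => hcomp (hρ j))
      (fun j => hcomp (hβ j)) (fun y hy => hO1 _ _ hy.2)
      (fun y hy => by
        have h1 : ρ i (φ.symm y) = 1 := hO1 _ _ hy.2
        simp only [Function.comp_apply, β, h1, one_smul]
        exact φ.right_inv hy.1)
    rw [finrank_euclideanSpace_fin] at key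
    refine (dimH_mono ?_).trans key
    rintro q ⟨x, hx, hx0, hx1⟩
    have hxs : x ∈ φ.source := hOs i hx
    have hinv : φ.symm (φ x) = x := φ.left_inv hxs
    have hmem : φ x ∈ W := ⟨φ.map_source hxs, by rw [mem_preimage, hinv]; exact hx⟩
    refine ⟨φ x, hmem, ?_, ?_⟩
    · simp only [Function.comp_apply, hinv]
      exact hx0
    · have hd : MDifferentiableAt (𝓡 n) 𝓘(ℝ, ℝ) (fun x => u₀ x - pert q x) (φ.symm (φ x)) :=
        (hu q).mdifferentiableAt (by simp)
      have hd' : MDifferentiableAt 𝓘(ℝ, E) (𝓡 n) φ.symm (φ x) :=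
        (hsymm.contMDiffAt (hWo.mem_nhds hmem)).mdifferentiableAt (by simp)
      have := mfderiv_comp (φ x) hd hd'
      rw [hinv, hx1, mfderiv_eq_fderiv] at this
      exact this.trans (ContinuousLinearMap.zero_comp _)
  -- Each bad set has dimension at most one less than the parameter space, so good parameters are
  -- dense, in particular near 0.
  have hall : dimH (⋃ i, bad i) < Module.finrank ℝ (ι → P) := by
    rw [dimH_iUnion]
    refine (iSup_le hbad).trans_lt ?_
    rw [Module.finrank_pi_fintype]
    simp only [P, finrank_dual_prod, Finset.sum_const, Finset.card_univ, smul_eq_mul, E,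
      finrank_euclideanSpace_fin]
    norm_cast
    have hpos : 0 < Fintype.card ι := Fintype.card_pos
    obtain ⟨m, hm⟩ := Nat.exists_eq_succ_of_ne_zero hpos.ne'
    rw [hm, Nat.succ_sub_one, Nat.succ_mul]
    omega
  have hdense := dense_compl_of_dimH_lt_finrank hall
  have hsmall : ∀ᶠ q in 𝓝 (0 : ι → P), ∑ i, (‖(q i).1‖ * C i + |(q i).2|) < ε := by
    have hc : Continuous fun q : ι → P => ∑ i, (‖(q i).1‖ * C i + |(q i).2|) := by
      refine continuous_finsetSum _ fun i _ => ?_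
      have h1 : Continuous fun q : ι → P => (q i).1 := continuous_fst.comp (continuous_apply i)
      have h2 : Continuous fun q : ι → P => (q i).2 := continuous_snd.comp (continuous_apply i)
      exact (h1.norm.mul_const _).add h2.abs
    have := hc.tendsto 0
    simp only [Pi.zero_apply, Prod.fst_zero, norm_zero, zero_mul, Prod.snd_zero, abs_zero, add_zero,
      Finset.sum_const_zero] at this
    exact this.eventually_lt_const hε
  obtain ⟨q, hq, hqb⟩ := hdense.inter_nhds_nonempty hsmall
  refine ⟨fun x => u₀ x - pert q x, hu q, fun x => ?_, fun x hx h0 h1 => ?_⟩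
  · rw [sub_sub_cancel_left, abs_neg]
    refine lt_of_le_of_lt ?_ hqb
    refine (Finset.abs_sum_le_sum_abs _ _).trans (Finset.sum_le_sum fun i _ => ?_)
    refine (abs_add_le _ _).trans (add_le_add ?_ ?_)
    · rw [← Real.norm_eq_abs]
      exact ((q i).1.le_opNorm _).trans (by gcongr; exact hC i x)
    · rw [abs_mul]
      refine mul_le_of_le_one_right (abs_nonneg _) ?_
      rw [abs_of_nonneg (ρ i).nonneg]
      exact (ρ i).le_one
  · obtain ⟨i, hi, hxi⟩ := mem_iUnion₂.1 (hT hx)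
    exact hq (mem_iUnion.2 ⟨⟨i, hi⟩, x, hxi, h0, h1⟩)

end RegularPerturbation

/-! ### Regular sets as superlevel sets -/

section SuperlevelSets

/-- Near a zero at which its differential does not vanish, the superlevel set `{0 ≤ w}` of a `C¹`
function is locally connected. -/
theorem exists_isPreconnected_superlevel {E : Type*} [NormedAddCommGroup E] [NormedSpace ℝ E]
    {w : E → ℝ} {T : Set E} (hT : IsOpen T) (hw : ContDiffOn ℝ 1 w T) {y₀ : E} (hy₀ : y₀ ∈ T)
    (h0 : w y₀ = 0) (hd : fderiv ℝ w y₀ ≠ 0) :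
    ∃ N ∈ 𝓝 y₀, ∃ S, IsPreconnected S ∧ S ⊆ T ∩ {y | 0 ≤ w y} ∧ N ∩ {y | 0 ≤ w y} ⊆ S := by
  obtain ⟨v, hv⟩ : ∃ v, 0 < fderiv ℝ w y₀ v := by
    obtain ⟨v, hv⟩ : ∃ v, fderiv ℝ w y₀ v ≠ 0 := by
      by_contra! h
      exact hd (ContinuousLinearMap.ext h)
    rcases lt_or_gt_of_ne hv with h | h
    · exact ⟨-v, by rw [map_neg]; linarith⟩
    · exact ⟨v, h⟩
  have hc : ContinuousAt (fun y => fderiv ℝ w y v) y₀ :=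
    ((hw.continuousOn_fderiv_of_isOpen hT le_rfl).continuousAt (hT.mem_nhds hy₀)).clm_apply
      continuousAt_const
  obtain ⟨R, hR, hball⟩ := Metric.mem_nhds_iff.1
    (inter_mem (hT.mem_nhds hy₀) (hc.eventually_const_lt hv))
  have hvpos : 0 < ‖v‖ := norm_pos_iff.2 fun h => by simp [h] at hv
  -- With this `t`, moving from the half ball by up to `t • v` stays in the ball of radius `R`,
  -- where `w` increases in the direction `v`.
  set t := R / (4 * ‖v‖) with ht
  have htpos : 0 < t := by positivity
  have htv : t * ‖v‖ < R / 2 := by rw [ht]; field_simp; linarith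
  have hin : ∀ y ∈ Metric.ball y₀ (R / 2), ∀ s ∈ Icc 0 t, y + s • v ∈ Metric.ball y₀ R := by
    intro y hy s hs
    rw [Metric.mem_ball, dist_eq_norm] at hy ⊢
    have h1 : ‖s • v‖ ≤ t * ‖v‖ := by
      rw [norm_smul, Real.norm_eq_abs, abs_of_nonneg hs.1]
      exact mul_le_mul_of_nonneg_right hs.2 hvpos.le
    calc ‖y + s • v - y₀‖ = ‖(y - y₀) + s • v‖ := by congr 1; abel
      _ ≤ ‖y - y₀‖ + ‖s • v‖ := norm_add_le _ _
      _ < R := by linarith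
  have hmono : ∀ y ∈ Metric.ball y₀ (R / 2), StrictMonoOn (fun s : ℝ => w (y + s • v)) (Icc 0 t) := by
    intro y hy
    have hder : ∀ s ∈ Icc 0 t, HasDerivAt (fun s : ℝ => w (y + s • v))
        (fderiv ℝ w (y + s • v) v) s := by
      intro s hs
      have h1 : HasFDerivAt w (fderiv ℝ w (y + s • v)) (y + s • v) :=
        ((hw.contDiffAt (hT.mem_nhds (hball (hin y hy s hs)).1)).differentiableAt
          one_ne_zero).hasFDerivAt
      have h2 : HasDerivAt (fun s : ℝ => y + s • v) v s := by
        simpa using ((hasDerivAt_id s).smul_const v).const_add y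
      exact h1.comp_hasDerivAt s h2
    refine strictMonoOn_of_deriv_pos (convex_Icc 0 t)
      (fun s hs => (hder s hs).continuousAt.continuousWithinAt) fun s hs => ?_
    rw [interior_Icc] at hs
    rw [(hder s (Ioo_subset_Icc_self hs)).deriv]
    exact (hball (hin y hy s (Ioo_subset_Icc_self hs))).2
  have h0t : (0 : ℝ) ∈ Icc 0 t := ⟨le_rfl, htpos.le⟩
  have htt : t ∈ Icc 0 t := ⟨htpos.le, le_rfl⟩
  have hy₀b : y₀ ∈ Metric.ball y₀ (R / 2) := Metric.mem_ball_self (by linarith)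
  have hwt : 0 < w (y₀ + t • v) := by
    have := hmono y₀ hy₀b h0t htt htpos
    simpa [h0] using this
  have hmem : y₀ + t • v ∈ T := (hball (hin y₀ hy₀b t htt)).1
  have hcw : ContinuousAt w (y₀ + t • v) := (hw.contDiffAt (hT.mem_nhds hmem)).continuousAt
  obtain ⟨r, hr, hrball⟩ := Metric.mem_nhds_iff.1
    (inter_mem (hT.mem_nhds hmem) (hcw.eventually_const_lt hwt))
  let N := Metric.ball y₀ (min r (R / 2))
  -- Every nearby point of the superlevel set is pushed along `v`, with `w` increasing, into one
  -- common ball on which `w` is positive; the union of these paths is connected.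
  let c : Set (Set E) := (fun y => segment ℝ y (y + t • v) ∪ Metric.ball (y₀ + t • v) r) ''
    (N ∩ {y | 0 ≤ w y})
  refine ⟨N, Metric.ball_mem_nhds _ (by positivity), ⋃₀ c, ?_, ?_, ?_⟩
  · refine isPreconnected_sUnion (y₀ + t • v) c ?_ ?_
    · rintro _ ⟨y, -, rfl⟩
      exact Or.inr (Metric.mem_ball_self hr)
    · rintro _ ⟨y, hy, rfl⟩
      refine IsPreconnected.union (y + t • v) (right_mem_segment ℝ _ _) ?_
        (convex_segment _ _).isPreconnected (convex_ball _ _).isPreconnected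
      have := hy.1
      rw [Metric.mem_ball, dist_eq_norm] at this ⊢
      rw [add_sub_add_right_eq_sub]
      exact this.trans_le (min_le_left _ _)
  · rintro z ⟨_, ⟨y, hy, rfl⟩, hz | hz⟩
    · have hyb : y ∈ Metric.ball y₀ (R / 2) := Metric.ball_subset_ball (min_le_right _ _) hy.1
      rw [segment_eq_image'] at hz
      obtain ⟨θ, hθ, rfl⟩ := hz
      simp only [add_sub_cancel_left, smul_smul]
      have hθt : θ * t ∈ Icc 0 t :=
        ⟨mul_nonneg hθ.1 htpos.le, mul_le_of_le_one_left htpos.le hθ.2⟩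
      refine ⟨(hball (hin y hyb _ hθt)).1, ?_⟩
      have h1 := (hmono y hyb).monotoneOn h0t hθt hθt.1
      simp only [zero_smul, add_zero] at h1
      exact le_trans hy.2 h1
    · have h2 : 0 < w z := (hrball hz).2
      exact ⟨(hrball hz).1, h2.le⟩
  · intro y hy
    exact ⟨_, ⟨y, hy, rfl⟩, Or.inl (left_mem_segment ℝ _ _)⟩

variable {n : ℕ} {X : Type*} [TopologicalSpace X]
  [ChartedSpace (EuclideanSpace ℝ (Fin n)) X]

theorem IsLocalExtr.mfderiv_eq_zero {u : X → ℝ} {x : X} (h : IsLocalExtr u x) :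
    mfderiv (𝓡 n) 𝓘(ℝ, ℝ) u x = 0 := by
  by_cases hd : MDifferentiableAt (𝓡 n) 𝓘(ℝ, ℝ) u x
  · have hx : (extChartAt (𝓡 n) x).symm (extChartAt (𝓡 n) x x) = x := extChartAt_to_inv x
    have hc : ContinuousAt (extChartAt (𝓡 n) x).symm (extChartAt (𝓡 n) x x) :=
      continuousAt_extChartAt_symm x
    have h' : IsLocalExtr (u ∘ (extChartAt (𝓡 n) x).symm) (extChartAt (𝓡 n) x x) := by
      have h1 : IsExtrFilter u (𝓝 x) ((extChartAt (𝓡 n) x).symm (extChartAt (𝓡 n) x x)) := by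
        rw [hx]
        exact h
      refine IsExtrFilter.comp_tendsto h1 ?_
      rw [ContinuousAt, hx] at hc
      exact hc
    rw [hd.mfderiv]
    simp only [writtenInExtChartAt, extChartAt_model_space_eq_id, PartialEquiv.refl_coe,
      Function.id_comp, ModelWithCorners.range_eq_univ, fderivWithin_univ]
    exact h'.fderiv_eq_zero
  · exact mfderiv_zero_of_not_mdifferentiableAt hd

variable [IsManifold (𝓡 n) ∞ X]

/-- Where `u` is positive this is local connectedness of the manifold; at a zero the Euclidean
statement is transported through a chart. It makes the components of the superlevel set relatively
open. -/
theorem exists_isPreconnected_nhds_superlevel {u : X → ℝ} (hu : ContMDiff (𝓡 n) 𝓘(ℝ, ℝ) ∞ u)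
    (hreg : ∀ x, u x = 0 → mfderiv (𝓡 n) 𝓘(ℝ, ℝ) u x ≠ 0) {x : X} (hx : 0 ≤ u x) :
    ∃ N ∈ 𝓝 x, ∃ S, IsPreconnected S ∧ S ⊆ {y | 0 ≤ u y} ∧ N ∩ {y | 0 ≤ u y} ⊆ S := by
  rcases hx.lt_or_eq with hx | hx
  · have : LocallyConnectedSpace X :=
      ChartedSpace.locallyConnectedSpace (EuclideanSpace ℝ (Fin n)) X
    have hN : {y | 0 < u y} ∈ 𝓝 x := hu.continuous.continuousAt.eventually_const_lt hx
    have hsub : {y | 0 < u y} ⊆ {y | 0 ≤ u y} := fun y (hy : 0 < u y) => hy.le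
    exact ⟨_, connectedComponentIn_mem_nhds hN, _, isPreconnected_connectedComponentIn,
      (connectedComponentIn_subset _ _).trans hsub, inter_subset_left⟩
  · set φ := extChartAt (𝓡 n) x with hφ
    have hsymm : ContMDiffOn 𝓘(ℝ, EuclideanSpace ℝ (Fin n)) (𝓡 n) ∞ φ.symm φ.target :=
      contMDiffOn_extChartAt_symm x
    have hw : ContDiffOn ℝ 1 (u ∘ φ.symm) φ.target :=
      (contMDiffOn_iff_contDiffOn.1 (hu.comp_contMDiffOn hsymm)).of_le ENat.LEInfty.out
    have hxx : φ.symm (φ x) = x := extChartAt_to_inv x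
    have hd : fderiv ℝ (u ∘ φ.symm) (φ x) ≠ 0 := by
      have h1 := hreg x hx.symm
      rw [(hu.mdifferentiableAt (by simp)).mfderiv] at h1
      simp only [writtenInExtChartAt, extChartAt_model_space_eq_id, PartialEquiv.refl_coe,
        Function.id_comp, ModelWithCorners.range_eq_univ, fderivWithin_univ] at h1
      exact h1
    obtain ⟨N, hN, S, hS, hST, hNS⟩ := exists_isPreconnected_superlevel
      (isOpen_extChartAt_target x) hw (mem_extChartAt_target x)
      (by rw [Function.comp_apply, extChartAt_to_inv, ← hx]) hd
    refine ⟨φ ⁻¹' N ∩ φ.source, inter_mem ((continuousAt_extChartAt x).preimage_mem_nhds hN)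
      (extChartAt_source_mem_nhds x), φ.symm '' S,
      hS.image _ ((continuousOn_extChartAt_symm x).mono fun y hy => (hST hy).1), ?_, ?_⟩
    · rintro _ ⟨y, hy, rfl⟩
      exact (hST hy).2
    · rintro y ⟨⟨hy, hys⟩, hyu⟩
      have hyy : φ.symm (φ y) = y := φ.left_inv hys
      exact ⟨φ y, hNS ⟨hy, by simpa [hyy] using hyu⟩, hyy⟩

/-- The compact superlevel set of a smooth function with regular value zero bounds a regular set. -/
theorem isRegularSet_superlevel {u : X → ℝ} (hu : ContMDiff (𝓡 n) 𝓘(ℝ, ℝ) ∞ u)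
    (hreg : ∀ x, u x = 0 → mfderiv (𝓡 n) 𝓘(ℝ, ℝ) u x ≠ 0) (hK : IsCompact {x | 0 ≤ u x})
    (hne : {x | 0 < u x}.Nonempty) : IsRegularSet n {x | 0 < u x} := by
  set K := {x | 0 ≤ u x} with hKdef
  have hKc : IsClosed K := isClosed_le continuous_const hu.continuous
  have hpos : IsOpen {x | 0 < u x} := isOpen_lt continuous_const hu.continuous
  choose! N hN S hS hSK hNS using
    fun x (hx : x ∈ K) => exists_isPreconnected_nhds_superlevel hu hreg hx
  have hNcomp : ∀ x ∈ K, N x ∩ K ⊆ connectedComponentIn K x := fun x hx =>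
    (hNS x hx).trans ((hS x hx).subset_connectedComponentIn
      (hNS x hx ⟨mem_of_mem_nhds (hN x hx), hx⟩) (hSK x hx))
  -- An interior point with `u = 0` would be a local minimum, hence critical, contrary to
  -- regularity.
  have hint : ∀ C ⊆ K, (∀ x ∈ C, ∃ V ∈ 𝓝 x, V ∩ K ⊆ C) → interior C = C ∩ {x | 0 < u x} := by
    intro C hCK hC
    refine Subset.antisymm (fun x hx => ⟨interior_subset hx, ?_⟩) fun x ⟨hxC, hx⟩ => ?_
    · by_contra h
      have h0 : u x = 0 := le_antisymm (not_lt.1 h) (hCK (interior_subset hx))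
      refine hreg x h0 (IsLocalExtr.mfderiv_eq_zero (Or.inl ?_))
      filter_upwards [mem_interior_iff_mem_nhds.1 hx] with y hy
      rw [h0]
      exact hCK hy
    · obtain ⟨V, hV, hVC⟩ := hC x hxC
      refine mem_interior_iff_mem_nhds.2 ?_
      filter_upwards [hV, hpos.mem_nhds hx] with y hyV hy
      exact hVC ⟨hyV, (show 0 < u y from hy).le⟩
  let 𝒞 : Set (Set X) := connectedComponentIn K '' K
  -- Components are relatively open in the compact set `K`, so there are finitely many.
  have h𝒞 : 𝒞.Finite := by
    obtain ⟨T, hTK, hT⟩ := hK.elim_nhds_subcover N hN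
    refine (T.finite_toSet.image (connectedComponentIn K)).subset ?_
    rintro _ ⟨y, hy, rfl⟩
    obtain ⟨x, hx, hyx⟩ := mem_iUnion₂.1 (hT hy)
    exact ⟨x, hx, connectedComponentIn_eq (hNcomp x (hTK x hx) ⟨hyx, hy⟩)⟩
  have h𝒞K : ∀ C ∈ 𝒞, C ⊆ K := by
    rintro _ ⟨x, hx, rfl⟩
    exact connectedComponentIn_subset _ _
  have h𝒞N : ∀ C ∈ 𝒞, ∀ x ∈ C, N x ∩ K ⊆ C := by
    rintro _ ⟨y, hy, rfl⟩ x hx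
    rw [connectedComponentIn_eq hx]
    exact hNcomp x (connectedComponentIn_subset _ _ hx)
  have h𝒞int : ∀ C ∈ 𝒞, interior C = C ∩ {x | 0 < u x} := fun C hC =>
    hint C (h𝒞K C hC) fun x hx => ⟨N x, hN x (h𝒞K C hC hx), h𝒞N C hC x hx⟩
  have h𝒞closed : ∀ C ∈ 𝒞, IsClosed C := by
    rintro _ ⟨x, hx, rfl⟩
    refine isClosed_of_closure_subset ?_
    exact isPreconnected_connectedComponentIn.closure.subset_connectedComponentIn
      (subset_closure (mem_connectedComponentIn hx))
      (closure_minimal (connectedComponentIn_subset _ _) hKc)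
  have h𝒞disj : ∀ C ∈ 𝒞, ∀ C' ∈ 𝒞, C ≠ C' → Disjoint C C' := by
    rintro _ ⟨x, hx, rfl⟩ _ ⟨y, hy, rfl⟩ hne
    rw [Set.disjoint_left]
    intro z hzx hzy
    exact hne ((connectedComponentIn_eq hzx).trans (connectedComponentIn_eq hzy).symm)
  have h𝒞conn : ∀ C ∈ 𝒞, IsConnected C := by
    rintro _ ⟨x, hx, rfl⟩
    exact isConnected_connectedComponentIn_iff.2 hx
  have h𝒞reg : ∀ C ∈ 𝒞, IsRegularDomain n (interior C) := by
    intro C hC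
    refine ⟨?_, C, h𝒞conn C hC, hK.of_isClosed_subset (h𝒞closed C hC) (h𝒞K C hC), ?_, rfl⟩
    · obtain ⟨x, hx⟩ := (h𝒞conn C hC).nonempty
      rw [h𝒞int C hC]
      by_contra hemp
      -- A component on which `u` vanishes identically would give a local maximum at a regular zero.
      have hloc : ∀ y ∈ N x, u y ≤ 0 := by
        intro y hy
        by_contra h
        exact hemp ⟨y, h𝒞N C hC x hx ⟨hy, (not_le.1 h).le⟩, not_le.1 h⟩
      have hxK := h𝒞K C hC hx
      have h0 : u x = 0 := le_antisymm (hloc x (mem_of_mem_nhds (hN x hxK))) hxK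
      refine hreg x h0 (IsLocalExtr.mfderiv_eq_zero (Or.inr ?_))
      filter_upwards [hN x hxK] with y hy
      rw [h0]
      exact hloc y hy
    · intro x hx
      have hxC : x ∈ C := (h𝒞closed C hC).frontier_subset hx
      have hxK := h𝒞K C hC hxC
      have h0 : u x = 0 := by
        refine le_antisymm (not_lt.1 fun h => ?_) hxK
        exact hx.2 (by rw [h𝒞int C hC]; exact ⟨hxC, h⟩)
      refine ⟨interior (N x), fun y => -u y, isOpen_interior,
        mem_interior_iff_mem_nhds.2 (hN x hxK), hu.neg.contMDiffOn, ?_, fun y hy => ?_⟩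
      · have : mfderiv (𝓡 n) 𝓘(ℝ, ℝ) (fun y => -u y) x = -mfderiv (𝓡 n) 𝓘(ℝ, ℝ) u x :=
          mfderiv_neg
        rw [this]
        exact neg_ne_zero.2 (hreg x h0)
      · rw [neg_nonpos]
        exact ⟨fun h => h𝒞K C hC h, fun h => h𝒞N C hC x hxC ⟨interior_subset hy, h⟩⟩
  have := h𝒞.to_subtype
  obtain ⟨k, ⟨e⟩⟩ := Finite.exists_equiv_fin 𝒞
  have hU : {x | 0 < u x} = ⋃ i, interior (e.symm i : Set X) := by
    ext x
    rw [mem_iUnion]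
    constructor
    · intro hx
      have hxK : x ∈ K := (show 0 < u x from hx).le
      let C : 𝒞 := ⟨connectedComponentIn K x, x, hxK, rfl⟩
      refine ⟨e C, ?_⟩
      rw [e.symm_apply_apply, h𝒞int _ C.2]
      exact ⟨mem_connectedComponentIn hxK, hx⟩
    · rintro ⟨i, hi⟩
      rw [h𝒞int _ (e.symm i).2] at hi
      exact hi.2
  refine ⟨k, fun i => interior (e.symm i : Set X), ?_, fun i => h𝒞reg _ (e.symm i).2, ?_, hU⟩
  · obtain ⟨x, hx⟩ := hne
    rw [hU, mem_iUnion] at hx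
    exact hx.choose.pos
  · intro i j hij
    have hcl : ∀ i, closure (interior (e.symm i : Set X)) ⊆ e.symm i := fun i =>
      closure_minimal interior_subset (h𝒞closed _ (e.symm i).2)
    exact (h𝒞disj _ (e.symm i).2 _ (e.symm j).2
      fun h => hij (e.symm.injective (Subtype.ext h))).mono (hcl i) (hcl j)

/-- Between a compact set and an open neighbourhood of it there is a regular set. -/
theorem exists_isRegularSet_between [T2Space X] [SigmaCompactSpace X] [LocallyCompactSpace X]
    {A B : Set X} (hA : IsCompact A)
    (hAne : A.Nonempty) (hB : IsOpen B) (hAB : A ⊆ B) :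
    ∃ D, IsRegularSet n D ∧ A ⊆ D ∧ closure D ⊆ B := by
  obtain ⟨L, hL, hAL, hLB⟩ := exists_compact_between hA hB hAB
  obtain ⟨f, hf0, hf1, -⟩ := exists_contMDiffMap_zero_one_of_isClosed (n := (⊤ : ℕ∞)) (𝓡 n)
    (isOpen_interior (s := L)).isClosed_compl hA.isClosed
    (disjoint_left.2 fun x hx hxA => hx (hAL hxA))
  -- The function is `1 / 2` on `A` and `-1 / 2` off the interior of `L`; an error below `1 / 4`
  -- preserves both signs.
  have hu₀ : ContMDiff (𝓡 n) 𝓘(ℝ, ℝ) ∞ (fun x => f x - 1 / 2) :=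
    f.contMDiff.sub contMDiff_const
  obtain ⟨u, hu, hclose, hreg⟩ := exists_contMDiff_regular_zero hL hu₀
    (show (0 : ℝ) < 1 / 4 by norm_num)
  have hsub : {x | 0 ≤ u x} ⊆ L := by
    intro x hx
    by_contra hxL
    have h1 := abs_lt.1 (hclose x)
    have h2 : f x = 0 := hf0 fun h => hxL (interior_subset h)
    have h3 : 0 ≤ u x := hx
    rw [h2] at h1
    linarith [h1.2]
  have hcl : IsClosed {x | 0 ≤ u x} := isClosed_le continuous_const hu.continuous
  have hAD : A ⊆ {x | 0 < u x} := by
    intro x hx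
    have h1 := abs_lt.1 (hclose x)
    have h2 : f x = 1 := hf1 hx
    rw [h2] at h1
    change 0 < u x
    linarith [h1.1]
  refine ⟨{x | 0 < u x}, isRegularSet_superlevel hu ?_ (hL.of_isClosed_subset hcl hsub)
    (hAne.mono hAD), hAD, ?_⟩
  · exact fun x hx => hreg x (hsub hx.ge) hx
  · have hsub' : {x | 0 < u x} ⊆ {x | 0 ≤ u x} := fun x (hx : 0 < u x) => hx.le
    exact (closure_minimal hsub' hcl).trans (hsub.trans hLB)

end SuperlevelSets

/-! ### Length spaces -/

section ShortConnections

/-- Any two points at distance less than `r` lie in a connected set all of whose points `z` satisfy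
`d(x, z) + d(z, y) < r`. This holds in every length space. -/
def HasShortConnections (X : Type*) [PseudoEMetricSpace X] : Prop :=
  ∀ (x y : X) (r : ENNReal), edist x y < r →
    ∃ S : Set X, IsPreconnected S ∧ x ∈ S ∧ y ∈ S ∧ ∀ z ∈ S, edist x z + edist z y < r

theorem IsPreconnected.inter_frontier_nonempty_of_mem {X : Type*} [TopologicalSpace X]
    {S D : Set X} (hS : IsPreconnected S) {x y : X} (hx : x ∈ S) (hxD : x ∈ D) (hy : y ∈ S)
    (hyD : y ∉ D) : (S ∩ frontier D).Nonempty := by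
  by_contra h
  rw [not_nonempty_iff_eq_empty, ← disjoint_iff_inter_eq_empty] at h
  have hcov : S ⊆ interior D ∪ (closure D)ᶜ := by
    intro z hz
    by_contra hz'
    rw [mem_union, not_or, notMem_compl_iff] at hz'
    exact disjoint_left.1 h hz ⟨hz'.2, hz'.1⟩
  have hxi : x ∈ interior D := (hcov hx).resolve_right fun h' => h' (subset_closure hxD)
  have hyi : y ∈ (closure D)ᶜ := (hcov hy).resolve_left fun h' => hyD (interior_subset h')
  obtain ⟨z, -, hz, hz'⟩ := hS _ _ isOpen_interior isClosed_closure.isOpen_compl hcov ⟨x, hx, hxi⟩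
    ⟨y, hy, hyi⟩
  exact hz' (interior_subset_closure hz)

/-- A connected set that joins a point of `D` to a point outside `D` meets the frontier, and a short
one does so near its starting point. -/
theorem HasShortConnections.infEDist_frontier_lt {X : Type*} [PseudoEMetricSpace X]
    (h : HasShortConnections X) {D : Set X} {x y : X} (hx : x ∈ D) (hy : y ∉ D) {r : ENNReal}
    (hr : edist x y < r) : Metric.infEDist x (frontier D) < r := by
  obtain ⟨S, hS, hxS, hyS, hz⟩ := h x y r hr
  obtain ⟨z, hzS, hzD⟩ := hS.inter_frontier_nonempty_of_mem hxS hx hyS hy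
  exact (Metric.infEDist_le_edist_of_mem hzD).trans_lt (le_self_add.trans_lt (hz z hzS))

theorem HasShortConnections.exists_edist_eq {X : Type*} [PseudoEMetricSpace X]
    (h : HasShortConnections X) {x y : X} {a b : ENNReal} (hr : edist x y < a + b)
    (ha : a ≤ edist x y) :
    ∃ z, edist x z = a ∧ edist z y < b := by
  obtain ⟨S, hS, hxS, hyS, hz⟩ := h x y _ hr
  obtain ⟨z, hzS, hza⟩ := hS.intermediate_value hxS hyS
    (f := fun z => edist x z) (by fun_prop) (show a ∈ Icc _ _ from ⟨by simp, ha⟩)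
  refine ⟨z, hza, ?_⟩
  have h1 := hz z hzS
  simp only at hza
  rw [hza] at h1
  exact lt_of_add_lt_add_left h1

/-- A length space in which all balls of some fixed radius are relatively compact is proper. -/
theorem HasShortConnections.properSpace {X : Type*} [MetricSpace X] (h : HasShortConnections X)
    {ε : ℝ} (hε : 0 < ε) (hc : ∀ x : X, IsCompact (Metric.closedBall x ε)) : ProperSpace X := by
  -- Every point of the larger ball is within `3 * ε / 4` of the smaller one, hence within `ε` of a
  -- finite `ε / 4`-net of the latter.
  have step : ∀ (x : X) (r : ℝ), 0 ≤ r → IsCompact (Metric.closedBall x r) →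
      IsCompact (Metric.closedBall x (r + ε / 2)) := by
    intro x r hr hxr
    obtain ⟨T, -, hT⟩ := hxr.elim_nhds_subcover (fun y => Metric.ball y (ε / 4))
      fun y _ => Metric.ball_mem_nhds y (by linarith)
    refine (T.isCompact_biUnion fun y _ => hc y).of_isClosed_subset Metric.isClosed_closedBall ?_
    intro z hz
    have hclose : ∃ w ∈ Metric.closedBall x r, dist w z < 3 * ε / 4 := by
      rcases le_or_gt (dist x z) r with hzr | hzr
      · exact ⟨z, by rwa [Metric.mem_closedBall'], by rw [dist_self]; linarith⟩
      · rw [Metric.mem_closedBall'] at hz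
        obtain ⟨w, hw, hwz⟩ := h.exists_edist_eq (x := x) (y := z) (a := ENNReal.ofReal r)
          (b := ENNReal.ofReal (3 * ε / 4))
          (by rw [edist_dist, ← ENNReal.ofReal_add hr (by linarith)]
              exact (ENNReal.ofReal_lt_ofReal_iff (by linarith)).2 (by linarith))
          (by rw [edist_dist]; exact ENNReal.ofReal_le_ofReal hzr.le)
        refine ⟨w, ?_, ?_⟩
        · rw [Metric.mem_closedBall', ← ENNReal.ofReal_le_ofReal_iff hr, ← edist_dist, hw]
        · rwa [edist_dist, ENNReal.ofReal_lt_ofReal_iff (by linarith)] at hwz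
    obtain ⟨w, hw, hwz⟩ := hclose
    obtain ⟨y, hy, hwy⟩ := mem_iUnion₂.1 (hT hw)
    refine mem_iUnion₂.2 ⟨y, hy, ?_⟩
    rw [Metric.mem_ball] at hwy
    rw [Metric.mem_closedBall]
    linarith [dist_triangle_left z y w]
  have hall : ∀ (x : X) (k : ℕ), IsCompact (Metric.closedBall x (k * (ε / 2))) := by
    intro x k
    induction k with
    | zero => simp
    | succ k ih =>
      have := step x _ (by positivity) ih
      convert this using 2
      push_cast
      ring
  refine ⟨fun x r => ?_⟩
  obtain ⟨k, hk⟩ := exists_nat_ge (r / (ε / 2))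
  refine (hall x k).of_isClosed_subset Metric.isClosed_closedBall
    (Metric.closedBall_subset_closedBall ?_)
  rwa [div_le_iff₀ (by linarith)] at hk

end ShortConnections

/-! ### Riemannian distance and volume in charts -/

section RiemannianVolume

attribute [local instance] normedAddCommGroupTangentSpaceVectorSpace
attribute [local instance] normedSpaceTangentSpaceVectorSpace

variable {n : ℕ} {X : Type*} [MetricSpace X]
    [ChartedSpace (EuclideanSpace ℝ (Fin n)) X]
    [Bundle.RiemannianBundle (fun x : X => TangentSpace (𝓡 n) x)]
    [IsRiemannianManifold (𝓡 n) X]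

/-- An almost shortest curve serves: any of its points splits its length into two lengths that bound
the two distances. -/
theorem hasShortConnections_of_isRiemannianManifold (n : ℕ) (X : Type*) [MetricSpace X]
    [ChartedSpace (EuclideanSpace ℝ (Fin n)) X]
    [Bundle.RiemannianBundle (fun x : X => TangentSpace (𝓡 n) x)]
    [IsRiemannianManifold (𝓡 n) X] : HasShortConnections X := by
  intro x y r hr
  rw [IsRiemannianManifold.out (I := 𝓡 n) x y] at hr
  obtain ⟨γ, h0, h1, hγ, hlen⟩ := exists_lt_of_riemannianEDist_lt hr
  refine ⟨γ '' Icc 0 1, isPreconnected_Icc.image _ hγ.continuousOn, ⟨0, by simp, h0⟩,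
    ⟨1, by simp, h1⟩, ?_⟩
  rintro _ ⟨t, ht, rfl⟩
  rw [IsRiemannianManifold.out (I := 𝓡 n) x, IsRiemannianManifold.out (I := 𝓡 n) _ y]
  refine lt_of_le_of_lt (add_le_add
    (riemannianEDist_le_pathELength (hγ.mono (Icc_subset_Icc_right ht.2)) h0 rfl ht.1)
    (riemannianEDist_le_pathELength (hγ.mono (Icc_subset_Icc_left ht.1)) rfl h1 ht.2)) ?_
  rwa [pathELength_add ht.1 ht.2]

variable [IsManifold (𝓡 n) ∞ X]
  [IsContMDiffRiemannianBundle (𝓡 n) ∞ (EuclideanSpace ℝ (Fin n))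
      (fun x : X => TangentSpace (𝓡 n) x)]

theorem isContinuousRiemannianBundle_tangentSpace (n : ℕ) (X : Type*) [TopologicalSpace X]
    [ChartedSpace (EuclideanSpace ℝ (Fin n)) X] [IsManifold (𝓡 n) ∞ X]
    [Bundle.RiemannianBundle (fun x : X => TangentSpace (𝓡 n) x)]
    [IsContMDiffRiemannianBundle (𝓡 n) ∞ (EuclideanSpace ℝ (Fin n))
      (fun x : X => TangentSpace (𝓡 n) x)] :
    IsContinuousRiemannianBundle (EuclideanSpace ℝ (Fin n))
      (fun x : X => TangentSpace (𝓡 n) x) := by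
  obtain ⟨g, hg, hg'⟩ := IsContMDiffRiemannianBundle.exists_contMDiff (IB := 𝓡 n) (n := ∞)
    (F := EuclideanSpace ℝ (Fin n)) (E := fun x : X => TangentSpace (𝓡 n) x)
  exact ⟨g, hg.continuous, hg'⟩

omit [IsRiemannianManifold (𝓡 n) X] in
theorem eventually_enorm_mfderivWithin_symm_extChartAt_apply_le (x : X) :
    ∃ C : NNReal, ∀ᶠ y in 𝓝 (extChartAt (𝓡 n) x x), ∀ v,
      ‖mfderivWithin 𝓘(ℝ, EuclideanSpace ℝ (Fin n)) (𝓡 n) (extChartAt (𝓡 n) x).symm univ y v‖ₑ ≤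
        C * ‖v‖ₑ := by
  have : IsManifold (𝓡 n) 1 X := .of_le (n := ∞) ENat.LEInfty.out
  have := isContinuousRiemannianBundle_tangentSpace n X
  obtain ⟨C, -, hC⟩ := eventually_enorm_mfderivWithin_symm_extChartAt_lt (𝓡 n) x
  rw [ModelWithCorners.range_eq_univ, nhdsWithin_univ] at hC
  exact ⟨C, hC.mono fun y hy v =>
    (ContinuousLinearMap.le_opENorm _ v).trans (mul_le_mul_left hy.le _)⟩

omit [IsRiemannianManifold (𝓡 n) X] in
theorem eventually_enorm_mfderiv_extChartAt_apply_le (x : X) :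
    ∃ C : NNReal, 0 < C ∧ ∀ᶠ y in 𝓝 x, ∀ v,
      ‖mfderiv (𝓡 n) 𝓘(ℝ, EuclideanSpace ℝ (Fin n)) (extChartAt (𝓡 n) x) y v‖ₑ ≤ C * ‖v‖ₑ := by
  have : IsManifold (𝓡 n) 1 X := .of_le (n := ∞) ENat.LEInfty.out
  have := isContinuousRiemannianBundle_tangentSpace n X
  obtain ⟨C, C_pos, hC⟩ := eventually_enorm_mfderiv_extChartAt_lt (𝓡 n) x
  exact ⟨C, C_pos, hC.mono fun y hy v =>
    (ContinuousLinearMap.le_opENorm _ v).trans (mul_le_mul_left hy.le _)⟩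

/-- The differential of the inverse chart is bounded near the base point, so straight segments in
the ball go to curves of comparable length. -/
theorem exists_lipschitzOnWith_extChartAt_symm (x : X) :
    ∃ (C : NNReal) (r : ℝ), 0 < r ∧ Metric.ball (extChartAt (𝓡 n) x x) r ⊆
      (extChartAt (𝓡 n) x).target ∧
      LipschitzOnWith C (extChartAt (𝓡 n) x).symm (Metric.ball (extChartAt (𝓡 n) x x) r) := by
  have : IsManifold (𝓡 n) 1 X := .of_le (n := ∞) ENat.LEInfty.out
  obtain ⟨C, hC⟩ := eventually_enorm_mfderivWithin_symm_extChartAt_apply_le (n := n) x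
  obtain ⟨r, r_pos, hr⟩ := Metric.mem_nhds_iff.1 (inter_mem (extChartAt_target_mem_nhds x) hC)
  refine ⟨C, r, r_pos, hr.trans inter_subset_left, fun y hy z hz => ?_⟩
  rw [IsRiemannianManifold.out (I := 𝓡 n)]
  let η := ContinuousAffineMap.lineMap (R := ℝ) y z
  set γ := (extChartAt (𝓡 n) x).symm ∘ η
  have hη : ∀ t ∈ Icc (0 : ℝ) 1, η t ∈ (extChartAt (𝓡 n) x).target ∧
        ∀ v, ‖mfderivWithin 𝓘(ℝ, EuclideanSpace ℝ (Fin n)) (𝓡 n) (extChartAt (𝓡 n) x).symm univ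
          (η t) v‖ₑ ≤ C * ‖v‖ₑ := by
    intro t ht
    refine hr ((convex_ball _ _).segment_subset hy hz ?_)
    rw [segment_eq_image_lineMap]
    exact ⟨t, ht, by simp [η, ContinuousAffineMap.coe_lineMap_eq]⟩
  have η_smooth : ContMDiffOn 𝓘(ℝ, ℝ) 𝓘(ℝ, EuclideanSpace ℝ (Fin n)) 1 η (Icc 0 1) := by
    apply ContMDiff.contMDiffOn
    rw [contMDiff_iff_contDiff]
    exact ContinuousAffineMap.contDiff _
  have h1 : riemannianEDist (𝓡 n) ((extChartAt (𝓡 n) x).symm y) ((extChartAt (𝓡 n) x).symm z) ≤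
      pathELength (𝓡 n) γ 0 1 := by
    apply riemannianEDist_le_pathELength _ _ _ zero_le_one
    · exact (contMDiffOn_extChartAt_symm x).comp η_smooth fun t ht => (hη t ht).1
    · simp [γ, η, ContinuousAffineMap.coe_lineMap_eq]
    · simp [γ, η, ContinuousAffineMap.coe_lineMap_eq]
  apply h1.trans
  rw [← lintegral_fderiv_lineMap_eq_edist, pathELength_eq_lintegral_mfderivWithin_Icc,
    ← lintegral_const_mul' _ _ ENNReal.coe_ne_top]
  apply setLIntegral_mono' measurableSet_Icc (fun t ht ↦ ?_)
  have h2 : mfderivWithin 𝓘(ℝ, ℝ) (𝓡 n) γ (Icc 0 1) t =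
      (mfderivWithin 𝓘(ℝ, EuclideanSpace ℝ (Fin n)) (𝓡 n) (extChartAt (𝓡 n) x).symm univ (η t)) ∘L
      (mfderivWithin 𝓘(ℝ, ℝ) 𝓘(ℝ, EuclideanSpace ℝ (Fin n)) η (Icc 0 1) t) := by
    apply mfderivWithin_comp
    · have := mdifferentiableWithinAt_extChartAt_symm (I := 𝓡 n) (hη t ht).1
      rwa [ModelWithCorners.range_eq_univ] at this
    · exact η_smooth.mdifferentiableOn one_ne_zero t ht
    · exact fun _ _ => mem_univ _
    · rw [uniqueMDiffWithinAt_iff_uniqueDiffWithinAt]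
      exact uniqueDiffOn_Icc zero_lt_one t ht
  have h3 : mfderivWithin 𝓘(ℝ, ℝ) (𝓡 n) γ (Icc 0 1) t 1 =
      (mfderivWithin 𝓘(ℝ, EuclideanSpace ℝ (Fin n)) (𝓡 n) (extChartAt (𝓡 n) x).symm univ (η t))
      (mfderivWithin 𝓘(ℝ, ℝ) 𝓘(ℝ, EuclideanSpace ℝ (Fin n)) η (Icc 0 1) t 1) := congr($h2 1)
  rw [h3]
  refine ((hη t ht).2 _).trans ?_
  simp only [mfderivWithin_eq_fderivWithin]
  exact le_of_eq rfl

/-- For points in the ball of a quarter of the radius `ρ`, almost shortest curves of length below `ρ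
/ 2` stay in the `ρ`-ball. There the chart's differential is bounded, so the chart expands their
length by at most `C`. -/
theorem exists_lipschitzOnWith_extChartAt (x : X) :
    ∃ (C : NNReal), ∃ N ∈ 𝓝 x, N ⊆ (extChartAt (𝓡 n) x).source ∧
      LipschitzOnWith C (extChartAt (𝓡 n) x) N := by
  have : IsManifold (𝓡 n) 1 X := .of_le (n := ∞) ENat.LEInfty.out
  obtain ⟨C, C_pos, hC⟩ := eventually_enorm_mfderiv_extChartAt_apply_le (n := n) x
  obtain ⟨ρ, ρ_pos, hρ⟩ := EMetric.mem_nhds_iff.1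
    (inter_mem (extChartAt_source_mem_nhds (I := 𝓡 n) x) hC)
  have hρ2 : 0 < ρ / 2 := ENNReal.half_pos ρ_pos.ne'
  have hρ4 : 0 < ρ / 2 / 2 := ENNReal.half_pos hρ2.ne'
  refine ⟨C, Metric.eball x (ρ / 2 / 2), Metric.eball_mem_nhds x hρ4, fun y hy => ?_,
    fun y hy z hz => ?_⟩
  · refine (hρ ?_).1
    refine lt_of_lt_of_le (Metric.mem_eball.1 hy) ?_
    exact ENNReal.half_le_self.trans ENNReal.half_le_self
  have hyz : edist y z < ρ / 2 := by
    calc edist y z ≤ edist y x + edist z x := edist_triangle_right _ _ _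
      _ < ρ / 2 / 2 + ρ / 2 / 2 := ENNReal.add_lt_add (Metric.mem_eball.1 hy) (Metric.mem_eball.1 hz)
      _ = ρ / 2 := ENNReal.add_halves _
  rw [mul_comm, ← ENNReal.div_le_iff_le_mul (Or.inl (by simpa using C_pos.ne'))
    (Or.inl ENNReal.coe_ne_top)]
  refine le_of_forall_gt_imp_ge_of_dense fun r hr => ?_
  have hr' : riemannianEDist (𝓡 n) y z < min r (ρ / 2) := by
    rw [← IsRiemannianManifold.out (I := 𝓡 n) y z]
    exact lt_min hr hyz
  obtain ⟨γ, h0, h1, hγ, hlen⟩ := exists_lt_of_riemannianEDist_lt hr'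
  have hin : ∀ t ∈ Icc (0 : ℝ) 1, γ t ∈ (extChartAt (𝓡 n) x).source ∧
      ∀ v, ‖mfderiv (𝓡 n) 𝓘(ℝ, EuclideanSpace ℝ (Fin n)) (extChartAt (𝓡 n) x) (γ t) v‖ₑ ≤
        C * ‖v‖ₑ := by
    intro t ht
    refine hρ ?_
    have h2 : edist (γ t) y < ρ / 2 := by
      rw [edist_comm, IsRiemannianManifold.out (I := 𝓡 n)]
      calc riemannianEDist (𝓡 n) y (γ t) ≤ pathELength (𝓡 n) γ 0 t :=
            riemannianEDist_le_pathELength (hγ.mono (Icc_subset_Icc_right ht.2)) h0 rfl ht.1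
        _ ≤ pathELength (𝓡 n) γ 0 1 := pathELength_mono le_rfl ht.2
        _ < ρ / 2 := hlen.trans_le (min_le_right _ _)
    calc edist (γ t) x ≤ edist (γ t) y + edist y x := edist_triangle _ _ _
      _ < ρ / 2 + ρ / 2 := ENNReal.add_lt_add h2
          (lt_of_lt_of_le (Metric.mem_eball.1 hy) ENNReal.half_le_self)
      _ = ρ := ENNReal.add_halves _
  rw [ENNReal.div_le_iff_le_mul (Or.inl (by simpa using C_pos.ne')) (Or.inl ENNReal.coe_ne_top)]
  let γ' := extChartAt (𝓡 n) x ∘ γ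
  have hγ' : ContMDiffOn 𝓘(ℝ, ℝ) 𝓘(ℝ, EuclideanSpace ℝ (Fin n)) 1 γ' (Icc 0 1) :=
    contMDiffOn_extChartAt.comp (I' := 𝓡 n)
      (t := (chartAt (EuclideanSpace ℝ (Fin n)) x).source)
      hγ (fun t ht => by simpa [extChartAt_source] using (hin t ht).1)
  calc edist (extChartAt (𝓡 n) x y) (extChartAt (𝓡 n) x z) = ‖γ' 1 - γ' 0‖ₑ := by
        rw [edist_comm, edist_eq_enorm_sub, ← h0, ← h1]
        rfl
    _ ≤ ∫⁻ t in Icc 0 1, ‖derivWithin γ' (Icc 0 1) t‖ₑ := by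
      apply enorm_sub_le_lintegral_derivWithin_Icc_of_contDiffOn_Icc _ zero_le_one
      rwa [← contMDiffOn_iff_contDiffOn]
    _ = ∫⁻ t in Icc (0 : ℝ) 1,
        ‖mfderivWithin 𝓘(ℝ, ℝ) 𝓘(ℝ, EuclideanSpace ℝ (Fin n)) γ' (Icc 0 1) t 1‖ₑ := by
      simp_rw [← fderivWithin_derivWithin, mfderivWithin_eq_fderivWithin]
      rfl
    _ ≤ ∫⁻ t in Icc (0 : ℝ) 1, C * ‖mfderivWithin 𝓘(ℝ, ℝ) (𝓡 n) γ (Icc 0 1) t 1‖ₑ := by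
      apply setLIntegral_mono' measurableSet_Icc (fun t ht ↦ ?_)
      have h2 : mfderivWithin 𝓘(ℝ, ℝ) 𝓘(ℝ, EuclideanSpace ℝ (Fin n)) γ' (Icc 0 1) t =
          (mfderiv (𝓡 n) 𝓘(ℝ, EuclideanSpace ℝ (Fin n)) (extChartAt (𝓡 n) x) (γ t)) ∘L
          (mfderivWithin 𝓘(ℝ, ℝ) (𝓡 n) γ (Icc 0 1) t) := by
        apply mfderiv_comp_mfderivWithin
        · refine mdifferentiableAt_extChartAt ?_
          simpa [extChartAt_source] using (hin t ht).1
        · exact hγ.mdifferentiableOn one_ne_zero _ ht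
        · rw [uniqueMDiffWithinAt_iff_uniqueDiffWithinAt]
          exact uniqueDiffOn_Icc zero_lt_one _ ht
      have h3 : mfderivWithin 𝓘(ℝ, ℝ) 𝓘(ℝ, EuclideanSpace ℝ (Fin n)) γ' (Icc 0 1) t 1 =
          (mfderiv (𝓡 n) 𝓘(ℝ, EuclideanSpace ℝ (Fin n)) (extChartAt (𝓡 n) x) (γ t))
          (mfderivWithin 𝓘(ℝ, ℝ) (𝓡 n) γ (Icc 0 1) t 1) := congr($h2 1)
      rw [h3]
      exact (hin t ht).2 _
    _ = C * pathELength (𝓡 n) γ 0 1 := by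
      rw [lintegral_const_mul' _ _ ENNReal.coe_ne_top, pathELength_eq_lintegral_mfderivWithin_Icc]
    _ ≤ r * C := by
      rw [mul_comm]
      gcongr
      exact hlen.le.trans (min_le_left _ _)

variable [MeasurableSpace X] [BorelSpace X]

/-- The Lipschitz image of a Euclidean ball is a neighbourhood of finite Hausdorff measure. -/
theorem isLocallyFiniteMeasure_riemannianVolume :
    IsLocallyFiniteMeasure (μHE[n] : Measure X) := by
  refine ⟨fun x => ?_⟩
  obtain ⟨C, r, hr, hsub, hC⟩ := exists_lipschitzOnWith_extChartAt_symm (n := n) x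
  refine ⟨(extChartAt (𝓡 n) x).symm '' Metric.ball (extChartAt (𝓡 n) x x) r, ?_, ?_⟩
  · have h1 : (extChartAt (𝓡 n) x) ⁻¹' Metric.ball (extChartAt (𝓡 n) x x) r ∈ 𝓝 x :=
      (continuousAt_extChartAt x).preimage_mem_nhds (Metric.ball_mem_nhds _ hr)
    filter_upwards [h1, extChartAt_source_mem_nhds (I := 𝓡 n) x] with y hy hys
    exact ⟨_, hy, (extChartAt (𝓡 n) x).left_inv hys⟩
  · rw [Measure.euclideanHausdorffMeasure_def, Measure.smul_apply]
    have h1 := hC.hausdorffMeasure_image_le (d := n) (by positivity)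
    have h2 : μH[n] (Metric.ball (extChartAt (𝓡 n) x x) r) < ⊤ := by
      have : (μH[n] : Measure (EuclideanSpace ℝ (Fin n))).IsAddHaarMeasure := by
        have := isAddHaarMeasure_hausdorffMeasure (E := EuclideanSpace ℝ (Fin n))
        rwa [finrank_euclideanSpace_fin] at this
      exact measure_ball_lt_top
    exact ENNReal.mul_lt_top ENNReal.coe_lt_top
      (h1.trans_lt (ENNReal.mul_lt_top (by simp) h2))

/-- The chart is Lipschitz, so it would map a null open set to a null set containing a Euclidean
neighbourhood. -/
theorem isOpenPosMeasure_riemannianVolume :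
    (μHE[n] : Measure X).IsOpenPosMeasure := by
  refine ⟨fun U hU ⟨x, hx⟩ h0 => ?_⟩
  obtain ⟨C, N, hN, hNs, hC⟩ := exists_lipschitzOnWith_extChartAt (n := n) x
  rw [Measure.euclideanHausdorffMeasure_def, Measure.smul_apply] at h0
  have h0' : μH[n] U = 0 := by
    refine (mul_eq_zero.1 h0).resolve_left ?_
    simpa using Measure.addHaarScalarFactor_volume_hausdorffMeasure_ne_zero n
  have h1 := (hC.mono (inter_subset_left (t := U))).hausdorffMeasure_image_le (d := n)
    (by positivity)
  rw [measure_mono_null inter_subset_right h0', mul_zero, nonpos_iff_eq_zero] at h1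
  have h2 : extChartAt (𝓡 n) x '' (N ∩ U) ∈ 𝓝 (extChartAt (𝓡 n) x x) := by
    have h3 : (extChartAt (𝓡 n) x).symm ⁻¹' (N ∩ U) ∈ 𝓝 (extChartAt (𝓡 n) x x) := by
      refine (continuousAt_extChartAt_symm x).preimage_mem_nhds ?_
      rw [extChartAt_to_inv]
      exact inter_mem hN (hU.mem_nhds hx)
    filter_upwards [h3, extChartAt_target_mem_nhds (I := 𝓡 n) x] with y hy hyt
    exact ⟨_, hy, (extChartAt (𝓡 n) x).right_inv hyt⟩
  have : (μH[n] : Measure (EuclideanSpace ℝ (Fin n))).IsAddHaarMeasure := by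
    have := isAddHaarMeasure_hausdorffMeasure (E := EuclideanSpace ℝ (Fin n))
    rwa [finrank_euclideanSpace_fin] at this
  exact (Measure.measure_pos_of_mem_nhds _ h2).ne' h1

end RiemannianVolume

/-! ### Deck transformations of the universal covering -/

section DeckTransformations

/-- Deck transformations act by evaluation. -/
instance deckGroupMulAction {X M : Type*} [TopologicalSpace X] (p : X → M) :
    MulAction (deckGroup p) X where
  smul γ x := (γ : X ≃ₜ X) x
  one_smul _ := rfl
  mul_smul _ _ _ := rfl

theorem deckGroup_smul_def {X M : Type*} [TopologicalSpace X] {p : X → M} (γ : deckGroup p)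
    (x : X) : γ • x = (γ : X ≃ₜ X) x := rfl

theorem deckGroup_map_smul {X M : Type*} [TopologicalSpace X] {p : X → M} (γ : deckGroup p)
    (x : X) : p (γ • x) = p x := γ.2 x

variable {X M : Type*} [TopologicalSpace X] [TopologicalSpace M] {p : X → M}

/-- Simple connectedness lifts `p` through itself, once sending `x` to `y` and once `y` to `x`;
uniqueness of lifts makes the two lifts mutually inverse. -/
theorem IsCoveringMap.exists_deckGroup_smul_eq [SimplyConnectedSpace X] [LocallyPathConnectedSpace X]
    (hp : IsCoveringMap p) {x y : X} (h : p x = p y) : ∃ γ : deckGroup p, γ • x = y := by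
  let f : C(X, M) := ⟨p, hp.continuous⟩
  obtain ⟨F, ⟨hF, hpF⟩, -⟩ := hp.existsUnique_continuousMap_lifts f x y h.symm
  obtain ⟨F', ⟨hF', hpF'⟩, -⟩ := hp.existsUnique_continuousMap_lifts f y x h
  have h1 : (F' : X → X) ∘ F = id := by
    refine hp.eq_of_comp_eq (F'.continuous.comp F.continuous) continuous_id ?_ x (by simp [hF, hF'])
    rw [← Function.comp_assoc, hpF']
    exact hpF
  have h2 : (F : X → X) ∘ F' = id := by
    refine hp.eq_of_comp_eq (F.continuous.comp F'.continuous) continuous_id ?_ y (by simp [hF, hF'])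
    rw [← Function.comp_assoc, hpF]
    exact hpF'
  exact ⟨⟨⟨⟨F, F', congrFun h1, congrFun h2⟩, F.continuous, F'.continuous⟩, congrFun hpF⟩, hF⟩

theorem IsCoveringMap.deckGroup_eq_of_smul_eq [PreconnectedSpace X] (hp : IsCoveringMap p)
    {γ γ' : deckGroup p} {x : X} (h : γ • x = γ' • x) : γ = γ' := by
  have : ((γ : X ≃ₜ X) : X → X) = (γ' : X ≃ₜ X) := by
    refine hp.eq_of_comp_eq (γ : X ≃ₜ X).continuous (γ' : X ≃ₜ X).continuous ?_ x h
    exact (funext γ.2).trans (funext γ'.2).symm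
  exact Subtype.ext (Homeomorph.ext (congrFun this))

/-- A covering space of a compact space contains a compact set that surjects onto the base. -/
theorem IsCoveringMap.exists_isCompact_image_eq_univ [LocallyCompactSpace X] [CompactSpace M]
    (hp : IsCoveringMap p) (hs : Function.Surjective p) :
    ∃ K : Set X, IsCompact K ∧ p '' K = univ := by
  choose C hC hCn using fun x : X => exists_compact_mem_nhds x
  choose s hs using hs
  obtain ⟨T, -, hT⟩ := isCompact_univ.elim_nhds_subcover (fun m => p '' C (s m))
    fun m _ => by
      have := hp.isOpenMap.image_mem_nhds (hCn (s m))
      rwa [hs m] at this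
  refine ⟨⋃ m ∈ T, C (s m), T.isCompact_biUnion fun m _ => hC _, ?_⟩
  rw [image_iUnion₂]
  exact univ_subset_iff.1 hT

end DeckTransformations

/-! ### The deck group acts properly by isometries -/

section Isometries

/-- By compactness of `K ×ˢ L` the claim is local at a pair `(x, y)`. If `p x ≠ p y`, separating the
images leaves no `γ`. Otherwise an isometry `γ` moving a point near `x` to one near `y` must send
`x` to `y`, since `p` is injective near `y`; this determines `γ`. -/
theorem IsCoveringMap.finite_setOf_smul_inter_nonempty {X M : Type*} [MetricSpace X]
    [PreconnectedSpace X] [TopologicalSpace M] [T2Space M] {p : X → M} (hp : IsCoveringMap p)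
    [IsIsometricSMul (deckGroup p) X] {K L : Set X} (hK : IsCompact K) (hL : IsCompact L) :
    {γ : deckGroup p | (γ • K ∩ L).Nonempty}.Finite := by
  have hloc : ∀ z : X × X, ∃ W ∈ 𝓝 z, {γ : deckGroup p | ∃ x, (x, γ • x) ∈ W}.Finite := by
    rintro ⟨x, y⟩
    by_cases hxy : p x = p y
    · obtain ⟨V, hVo, hyV, hV⟩ := hp.isLocalHomeomorph.isLocallyInjective y
      obtain ⟨r, hr, hrV⟩ := Metric.isOpen_iff.1 hVo y hyV
      refine ⟨Metric.ball x (r / 2) ×ˢ Metric.ball y (r / 2), prod_mem_nhds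
        (Metric.ball_mem_nhds _ (by linarith)) (Metric.ball_mem_nhds _ (by linarith)), ?_⟩
      refine Set.Subsingleton.finite ?_
      have key : ∀ γ : deckGroup p, (∃ z, (z, γ • z) ∈ Metric.ball x (r / 2) ×ˢ
          Metric.ball y (r / 2)) → γ • x = y := by
        rintro γ ⟨z, hz, hγz⟩
        refine hV (hrV ?_) hyV ((deckGroup_map_smul γ x).trans hxy)
        rw [Metric.mem_ball'] at hz
        rw [Metric.mem_ball] at hγz ⊢
        have h1 : dist (γ • x) (γ • z) = dist x z := dist_smul _ _ _
        simp only at hz hγz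
        linarith [dist_triangle (γ • x) (γ • z) y]
      intro γ hγ γ' hγ'
      exact hp.deckGroup_eq_of_smul_eq ((key γ hγ).trans (key γ' hγ').symm)
    · obtain ⟨U, V, hU, hV, hxU, hyV, hUV⟩ := t2_separation hxy
      refine ⟨(p ⁻¹' U) ×ˢ (p ⁻¹' V), prod_mem_nhds ((hU.preimage hp.continuous).mem_nhds hxU)
        ((hV.preimage hp.continuous).mem_nhds hyV), ?_⟩
      convert Set.finite_empty
      rw [Set.eq_empty_iff_forall_notMem]
      rintro γ ⟨z, hz, hγz⟩
      refine disjoint_left.1 hUV hz ?_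
      rw [← deckGroup_map_smul γ z]
      exact hγz
  choose W hW hWf using hloc
  obtain ⟨T, -, hT⟩ := (hK.prod hL).elim_nhds_subcover W fun z _ => hW z
  refine (Set.Finite.biUnion T.finite_toSet fun z _ => hWf z).subset ?_
  rintro γ ⟨_, ⟨x, hx, rfl⟩, hxL⟩
  obtain ⟨z, hz, hxz⟩ := mem_iUnion₂.1 (hT (Set.mk_mem_prod hx hxL))
  exact mem_iUnion₂.2 ⟨z, hz, x, hxz⟩

variable {n : ℕ} {X : Type*} [MetricSpace X] [ChartedSpace (EuclideanSpace ℝ (Fin n)) X]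
    [IsManifold (𝓡 n) ∞ X]
    [Bundle.RiemannianBundle (fun x : X => TangentSpace (𝓡 n) x)]
    {M : Type*} [TopologicalSpace M]
    [ChartedSpace (EuclideanSpace ℝ (Fin n)) M] [IsManifold (𝓡 n) ∞ M]
    [Bundle.RiemannianBundle (fun x : M => TangentSpace (𝓡 n) x)]
    {p : X → M}

/-- Continuous maps commuting with a Riemannian covering are continuously differentiable. -/
theorem IsRiemannianCovering.contMDiff_of_comp_eq (hp : IsRiemannianCovering n p) {σ : X → X}
    (hσ : Continuous σ) (hpσ : ∀ x, p (σ x) = p x) : ContMDiff (𝓡 n) (𝓡 n) 1 σ := by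
  intro x
  have hX1 : IsManifold (𝓡 n) 1 X := .of_le (n := ∞) ENat.LEInfty.out
  have hM1 : IsManifold (𝓡 n) 1 M := .of_le (n := ∞) ENat.LEInfty.out
  let y := σ x
  let E := EuclideanSpace ℝ (Fin n)
  let φ := extChartAt (𝓡 n) y
  let ψ := extChartAt (𝓡 n) (p y)
  have hp1 : ContMDiff (𝓡 n) (𝓡 n) 1 p := hp.contMDiff.of_le ENat.LEInfty.out
  let P : E → E := ψ ∘ p ∘ φ.symm
  have hP : ContDiffAt ℝ 1 P (φ y) := by
    have := (contMDiffAt_iff.1 (hp1 y)).2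
    rwa [ModelWithCorners.range_eq_univ, contDiffWithinAt_univ] at this
  have hPd : HasFDerivAt P (fderiv ℝ P (φ y)) (φ y) :=
    (hP.differentiableAt one_ne_zero).hasFDerivAt
  have hder : mfderiv (𝓡 n) (𝓡 n) p y = fderiv ℝ P (φ y) := by
    rw [(hp1.mdifferentiableAt one_ne_zero).mfderiv, ModelWithCorners.range_eq_univ,
      fderivWithin_univ]
    rfl
  -- Norm preservation gives injectivity, and equal dimensions then give invertibility. By the
  -- inverse function theorem `p` has a local inverse of class `C¹`, and near `x` the map `σ` is
  -- this inverse composed with `p`.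
  have hinj : Function.Injective (fderiv ℝ P (φ y) : E → E) := by
    refine (injective_iff_map_eq_zero (fderiv ℝ P (φ y))).2 fun v hv => ?_
    have h1 := hp.norm_mfderiv y v
    have h2 : mfderiv (𝓡 n) (𝓡 n) p y v = 0 := (congrArg (fun L : E →L[ℝ] E => L v) hder).trans hv
    rw [h2, norm_zero] at h1
    exact (@norm_eq_zero (TangentSpace (𝓡 n) y) _ v).1 h1.symm
  let f' : E ≃L[ℝ] E :=
    (LinearEquiv.ofInjectiveEndo (fderiv ℝ P (φ y) : E →ₗ[ℝ] E) hinj).toContinuousLinearEquiv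
  have hPd' : HasFDerivAt P (f' : E →L[ℝ] E) (φ y) := by
    convert hPd
    ext v
    rfl
  let e := hP.toOpenPartialHomeomorph P hPd' one_ne_zero
  have hes : φ y ∈ e.source := hP.mem_toOpenPartialHomeomorph_source hPd' one_ne_zero
  let g := hP.localInverse hPd' one_ne_zero
  have hg : ContDiffAt ℝ 1 g (P (φ y)) := hP.to_localInverse hPd' one_ne_zero
  have hPy : P (φ y) = ψ (p x) := by
    simp only [P, φ, Function.comp_apply, extChartAt_to_inv]
    rw [hpσ x]
  have hgy : g (P (φ y)) = φ y := hP.localInverse_apply_image hPd' one_ne_zero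
  have hpx : p x ∈ (chartAt E (p y)).source := by
    rw [← hpσ x]
    exact mem_chart_source E (p y)
  have hψ : ContMDiffAt (𝓡 n) 𝓘(ℝ, E) 1 ψ (p x) :=
    contMDiffAt_extChartAt' hpx
  have hφ : ContMDiffAt 𝓘(ℝ, E) (𝓡 n) 1 φ.symm (g (P (φ y))) := by
    rw [hgy]
    exact (contMDiffOn_extChartAt_symm y).contMDiffAt (extChartAt_target_mem_nhds (I := 𝓡 n) y)
  have hmain : ContMDiffAt (𝓡 n) (𝓡 n) 1 (φ.symm ∘ g ∘ ψ ∘ p) x := by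
    have h1 : ContMDiffAt (𝓡 n) 𝓘(ℝ, E) 1 (ψ ∘ p) x := hψ.comp x (hp1 x)
    have h2 : ContMDiffAt 𝓘(ℝ, E) 𝓘(ℝ, E) 1 g ((ψ ∘ p) x) := by
      rw [Function.comp_apply, ← hPy]
      exact hg.contMDiffAt
    have h3 : ContMDiffAt (𝓡 n) 𝓘(ℝ, E) 1 (g ∘ ψ ∘ p) x := h2.comp x h1
    have h4 : ContMDiffAt 𝓘(ℝ, E) (𝓡 n) 1 φ.symm ((g ∘ ψ ∘ p) x) := by
      rw [Function.comp_apply, Function.comp_apply, ← hPy]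
      exact hφ
    exact h4.comp x h3
  refine hmain.congr_of_eventuallyEq ?_
  have h1 : ∀ᶠ x' in 𝓝 x, σ x' ∈ φ.source :=
    hσ.continuousAt.eventually_mem (extChartAt_source_mem_nhds (I := 𝓡 n) y)
  have h2 : ∀ᶠ x' in 𝓝 x, φ (σ x') ∈ e.source :=
    ((continuousAt_extChartAt y).comp hσ.continuousAt).eventually_mem (e.open_source.mem_nhds hes)
  filter_upwards [h1, h2] with x' hx1 hx2
  have h3 : P (φ (σ x')) = ψ (p x') := by
    simp only [P, Function.comp_apply]
    rw [φ.left_inv hx1, hpσ]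
  have h4 : g (P (φ (σ x'))) = φ (σ x') := e.left_inv hx2
  simp only [Function.comp_apply]
  rw [← h3, h4, φ.left_inv hx1]

/-- Both `p` and `p ∘ σ = p` preserve norms of tangent vectors, hence so does `σ`; it therefore
preserves lengths of curves. -/
theorem IsRiemannianCovering.edist_le_of_comp_eq [IsRiemannianManifold (𝓡 n) X]
    (hp : IsRiemannianCovering n p) {σ : X → X}
    (hσ : Continuous σ) (hpσ : ∀ x, p (σ x) = p x) (a b : X) : edist (σ a) (σ b) ≤ edist a b := by
  have hσ1 := hp.contMDiff_of_comp_eq hσ hpσ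
  have hnorm : ∀ (x : X) (v : TangentSpace (𝓡 n) x), ‖mfderiv (𝓡 n) (𝓡 n) σ x v‖ₑ = ‖v‖ₑ := by
    intro x v
    have h1 : mfderiv (𝓡 n) (𝓡 n) (p ∘ σ) x =
        (mfderiv (𝓡 n) (𝓡 n) p (σ x)).comp (mfderiv (𝓡 n) (𝓡 n) σ x) :=
      mfderiv_comp x (hp.contMDiff.mdifferentiableAt (by simp))
        (hσ1.mdifferentiableAt one_ne_zero)
    have h2 : ‖mfderiv (𝓡 n) (𝓡 n) (p ∘ σ) x v‖ = ‖v‖ := by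
      have : p ∘ σ = p := funext hpσ
      have h3 : ∀ q : X → M, q = p → ‖mfderiv (𝓡 n) (𝓡 n) q x v‖ = ‖v‖ := by
        rintro q rfl
        exact hp.norm_mfderiv x v
      exact h3 _ this
    rw [h1, ContinuousLinearMap.comp_apply] at h2
    have h3 := (hp.norm_mfderiv (σ x) (mfderiv (𝓡 n) (𝓡 n) σ x v)).symm.trans h2
    rw [← ofReal_norm, ← ofReal_norm, h3]
  refine le_of_forall_gt fun r hr => ?_
  rw [IsRiemannianManifold.out (I := 𝓡 n)] at hr ⊢
  obtain ⟨γ, h0, h1, hγ, hlen⟩ := exists_lt_of_riemannianEDist_lt hr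
  refine lt_of_le_of_lt (riemannianEDist_le_pathELength (γ := σ ∘ γ) (a := 0) (b := 1)
    (hσ1.comp_contMDiffOn hγ) (by simp [h0]) (by simp [h1]) zero_le_one) ?_
  refine lt_of_eq_of_lt ?_ hlen
  rw [pathELength_eq_lintegral_mfderivWithin_Icc, pathELength_eq_lintegral_mfderivWithin_Icc]
  refine setLIntegral_congr_fun measurableSet_Icc fun t ht => ?_
  have h2 : mfderivWithin 𝓘(ℝ, ℝ) (𝓡 n) (σ ∘ γ) (Icc 0 1) t =
      (mfderiv (𝓡 n) (𝓡 n) σ (γ t)).comp (mfderivWithin 𝓘(ℝ, ℝ) (𝓡 n) γ (Icc 0 1) t) := by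
    apply mfderiv_comp_mfderivWithin
    · exact hσ1.mdifferentiableAt one_ne_zero
    · exact hγ.mdifferentiableOn one_ne_zero _ ht
    · rw [uniqueMDiffWithinAt_iff_uniqueDiffWithinAt]
      exact uniqueDiffOn_Icc zero_lt_one _ ht
  change ‖mfderivWithin 𝓘(ℝ, ℝ) (𝓡 n) (σ ∘ γ) (Icc 0 1) t 1‖ₑ = _
  rw [h2]
  exact hnorm _ _

theorem IsRiemannianCovering.isIsometricSMul [IsRiemannianManifold (𝓡 n) X]
    (hp : IsRiemannianCovering n p) : IsIsometricSMul (deckGroup p) X := by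
  refine ⟨fun γ a b => le_antisymm ?_ ?_⟩
  · exact hp.edist_le_of_comp_eq (γ : X ≃ₜ X).continuous γ.2 a b
  · have := hp.edist_le_of_comp_eq (γ⁻¹ : deckGroup p).1.continuous (γ⁻¹).2 (γ • a) (γ • b)
    rwa [← deckGroup_smul_def, ← deckGroup_smul_def, inv_smul_smul, inv_smul_smul] at this

end Isometries

/-! ### Boundary neighbourhoods -/

section BoundaryNeighbourhoods

variable {X : Type*} [MetricSpace X]

theorem hBoundary_mono (D : Set X) {h h' : ℝ} (hh : h ≤ h') : hBoundary h D ⊆ hBoundary h' D :=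
  fun _ hx => le_trans hx (ENNReal.ofReal_le_ofReal hh)

theorem HasShortConnections.mem_hBoundary (hX : HasShortConnections X) {D : Set X} {x y z : X}
    {r : ℝ} (hx : x ∈ D) (hy : y ∉ D) (hxy : dist x y < r) (hzx : dist z x < r) :
    z ∈ hBoundary (2 * r) D := by
  have hr : 0 < r := dist_nonneg.trans_lt hxy
  have h1 : Metric.infEDist x (frontier D) < ENNReal.ofReal r :=
    hX.infEDist_frontier_lt hx hy (by rwa [edist_dist, ENNReal.ofReal_lt_ofReal_iff hr])
  have h2 : edist z x ≤ ENNReal.ofReal r := by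
    rw [edist_dist]
    exact ENNReal.ofReal_le_ofReal hzx.le
  change Metric.infEDist z (frontier D) ≤ ENNReal.ofReal (2 * r)
  rw [two_mul, ENNReal.ofReal_add hr.le hr.le]
  exact Metric.infEDist_le_infEDist_add_edist.trans (add_le_add h1.le h2)

end BoundaryNeighbourhoods

/-! ### Counting translates: property (P), means and Følner sets -/

section ProperActions

/-- Two translates through one point differ by an element that moves `K` to meet itself. -/
theorem exists_encard_setOf_mem_smul_le {G X : Type*} [Group G] [MulAction G X] {K : Set X}
    (hfin : {g : G | (g • K ∩ K).Nonempty}.Finite) :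
    ∃ N : ℕ, ∀ x, {g : G | x ∈ g • K}.encard ≤ N := by
  refine ⟨hfin.toFinset.card, fun x => ?_⟩
  rcases Set.eq_empty_or_nonempty {g : G | x ∈ g • K} with h | ⟨g₀, hg₀⟩
  · simp [h]
  have h1 : {g : G | x ∈ g • K} ⊆ (g₀ * ·) '' {g : G | (g • K ∩ K).Nonempty} := by
    intro g hg
    refine ⟨g₀⁻¹ * g, ⟨g₀⁻¹ • x, ?_, ?_⟩, by simp⟩
    · rw [mul_smul]
      exact Set.smul_mem_smul_set hg
    · exact Set.mem_smul_set_iff_inv_smul_mem.1 hg₀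
  refine (Set.encard_le_encard h1).trans ((Set.encard_image_le _ _).trans ?_)
  rw [hfin.encard_eq_coe_toFinset_card]

theorem measure_le_tsum_inter_smul {G X : Type*} [Group G] [MulAction G X]
    [MeasurableSpace X] {μ : Measure X} [Countable G] {K : Set X}
    (hcov : ∀ x : X, ∃ g : G, x ∈ g • K)
    (E : Set X) : μ E ≤ ∑' g : G, μ (E ∩ g • K) := by
  refine (measure_mono fun x hx => ?_).trans (measure_iUnion_le _)
  obtain ⟨g, hg⟩ := hcov x
  exact mem_iUnion.2 ⟨g, hx, hg⟩

variable {G X : Type*} [Group G] [MetricSpace X] [MulAction G X]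

theorem countable_of_proper [ProperSpace X] {K : Set X} (hne : K.Nonempty)
    (hfin : ∀ L : Set X, IsCompact L → {g : G | (g • K ∩ L).Nonempty}.Finite) : Countable G := by
  obtain ⟨x, hx⟩ := hne
  rw [← Set.countable_univ_iff]
  refine (Set.countable_iUnion fun k : ℕ =>
    (hfin _ (isCompact_closedBall x k)).countable).mono fun g _ => ?_
  obtain ⟨k, hk⟩ := exists_nat_ge (dist (g • x) x)
  exact mem_iUnion.2 ⟨k, g • x, Set.smul_mem_smul_set hx, hk⟩

variable [IsIsometricSMul G X] [MeasurableSpace X] [BorelSpace X] {μ : Measure X}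

/-- Tonelli: the indicators of the translates add up to at most `N` at every point. -/
theorem tsum_measure_inter_smul_le [Countable G] {K : Set X} (hK : IsCompact K) {N : ℕ}
    (hN : ∀ x, {g : G | x ∈ g • K}.encard ≤ N) (E : Set X) :
    ∑' g : G, μ (E ∩ g • K) ≤ N * μ E := by
  have hm : ∀ g : G, MeasurableSet (g • K) := fun g => (hK.smul g).isClosed.measurableSet
  calc ∑' g : G, μ (E ∩ g • K) = ∑' g : G, ∫⁻ x in E, (g • K).indicator 1 x ∂μ := by
        refine tsum_congr fun g => ?_
        rw [lintegral_indicator_one (hm g), Measure.restrict_apply (hm g), inter_comm]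
    _ = ∫⁻ x in E, ∑' g : G, (g • K).indicator 1 x ∂μ :=
        (lintegral_tsum fun g => (measurable_one.indicator (hm g)).aemeasurable).symm
    _ ≤ ∫⁻ _ in E, N ∂μ := by
        refine lintegral_mono fun x => ?_
        have : ∀ g : G, (g • K).indicator (1 : X → ENNReal) x =
            {g : G | x ∈ g • K}.indicator 1 g := fun g => rfl
        simp_rw [this]
        rw [← tsum_subtype {g : G | x ∈ g • K} (1 : G → ENNReal)]
        simp only [Pi.one_apply, ENNReal.tsum_set_one]
        exact_mod_cast hN x
    _ = N * μ E := by rw [setLIntegral_const]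

variable [SMulInvariantMeasure G X μ]

/-- A sequence of sets with small boundary neighbourhoods yields an invariant mean on a group that
acts properly and cocompactly. -/
theorem isAmenableGroup_of_tendsto_measure_hBoundary [IsLocallyFiniteMeasure μ] [Countable G]
    (hX : HasShortConnections X) {K : Set X} (hK : IsCompact K)
    (hfin : {g : G | (g • K ∩ K).Nonempty}.Finite)
    (hcov : ∀ x : X, ∃ g : G, x ∈ g • K) {D : ℕ → Set X}
    (h0 : ∀ k, μ (D k) ≠ 0) (htop : ∀ k, μ (D k) ≠ ⊤)
    (hlim : ∀ d : ℝ, 0 < d → Tendsto (fun k => μ (hBoundary d (D k)) / μ (D k)) atTop (𝓝 0)) :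
    IsAmenableGroup G := by
  obtain ⟨N, hN⟩ := exists_encard_setOf_mem_smul_le hfin
  let T : ℕ → ENNReal := fun k => ∑' g : G, μ (D k ∩ g • K)
  have hDT : ∀ k, μ (D k) ≤ T k := fun k => measure_le_tsum_inter_smul hcov (D k)
  have hT0 : ∀ k, T k ≠ 0 := fun k h => h0 k (le_zero_iff.1 ((hDT k).trans_eq h))
  have hTtop : ∀ k, T k ≠ ⊤ := fun k =>
    ne_top_of_le_ne_top (ENNReal.mul_ne_top (ENNReal.natCast_ne_top N) (htop k))
      (tsum_measure_inter_smul_le hK hN (D k))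
  have hb : ∀ (E : Set X) (g : G), μ (E ∩ g • K) ≠ ⊤ := fun E g =>
    ne_top_of_le_ne_top (hK.smul g).measure_lt_top.ne (measure_mono inter_subset_right)
  let a : ℕ → G → ℝ := fun k g => (μ (D k ∩ g • K) / T k).toReal
  refine isAmenableGroup_of_tendsto_tsum (a := a) (fun k g => ENNReal.toReal_nonneg) (fun k => ?_)
    fun h => ?_
  · have h1 : ∑' g : G, μ (D k ∩ g • K) / T k = 1 := by
      simp only [div_eq_mul_inv]
      rw [ENNReal.tsum_mul_right]
      exact ENNReal.mul_inv_cancel (hT0 k) (hTtop k)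
    have h2 := ENNReal.hasSum_toReal (f := fun g : G => μ (D k ∩ g • K) / T k) (by simp [h1])
    rwa [← ENNReal.tsum_toReal_eq fun g => ENNReal.div_ne_top (hb _ g) (hT0 k), h1,
      ENNReal.toReal_one] at h2
  · obtain ⟨R, hR⟩ : ∃ R : ℝ, ∀ y ∈ K, dist y (h • y) < R := by
      have hc : Continuous fun y : X => dist y (h • y) := by fun_prop
      obtain ⟨R, hR⟩ := (hK.image hc).bddAbove
      exact ⟨R + 1, fun y hy => lt_of_le_of_lt (hR ⟨y, hy, rfl⟩) (by linarith)⟩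
    have hR' : ∀ (k : ℕ) (g : G), ∀ y ∈ K, (g • y ∈ D k ∧ (g * h) • y ∉ D k ∨
        (g * h) • y ∈ D k ∧ g • y ∉ D k) → g • y ∈ hBoundary (2 * R) (D k) := by
      intro k g y hy hyD
      have h1 : dist (g • y) ((g * h) • y) < R := by
        rw [mul_smul, dist_smul]
        exact hR y hy
      rcases hyD with ⟨h2, h3⟩ | ⟨h2, h3⟩
      · exact hX.mem_hBoundary h2 h3 h1 (by rw [dist_self]; exact dist_nonneg.trans_lt h1)
      · exact hX.mem_hBoundary h2 h3 (by rwa [dist_comm]) h1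
    -- Pulled back to `K`, the pieces of `D k` in `g • K` and `(g * h) • K` are compared point by
    -- point.
    have hpre : ∀ (E : Set X) (g : G), μ (E ∩ g • K) = μ ((g • ·) ⁻¹' E ∩ K) := by
      intro E g
      rw [← measure_smul μ g ((g • ·) ⁻¹' E ∩ K), Set.smul_set_inter, Set.preimage_smul,
        smul_inv_smul]
    let b : ℕ → G → ENNReal := fun k g => μ (hBoundary (2 * R) (D k) ∩ g • K)
    have h1 : ∀ k g, μ (D k ∩ (g * h) • K) ≤ μ (D k ∩ g • K) + b k g := by
      intro k g
      simp only [b, hpre]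
      refine (measure_mono fun y hy => ?_).trans (measure_union_le _ _)
      by_cases hyD : g • y ∈ D k
      · exact Or.inl ⟨hyD, hy.2⟩
      · exact Or.inr ⟨hR' k g y hy.2 (Or.inr ⟨hy.1, hyD⟩), hy.2⟩
    have h2 : ∀ k g, μ (D k ∩ g • K) ≤ μ (D k ∩ (g * h) • K) + b k g := by
      intro k g
      simp only [b, hpre]
      refine (measure_mono fun y hy => ?_).trans (measure_union_le _ _)
      by_cases hyD : (g * h) • y ∈ D k
      · exact Or.inl ⟨hyD, hy.2⟩
      · exact Or.inr ⟨hR' k g y hy.2 (Or.inl ⟨hy.1, hyD⟩), hy.2⟩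
    have habs : ∀ k g, |a k (g * h) - a k g| ≤ (b k g / T k).toReal := by
      intro k g
      have hne : ∀ (E : Set X) (g : G), μ (E ∩ g • K) / T k ≠ ⊤ := fun E g =>
        ENNReal.div_ne_top (hb E g) (hT0 k)
      have h3 : a k (g * h) ≤ a k g + (b k g / T k).toReal := by
        rw [← ENNReal.toReal_add (hne _ _) (hne _ _), ← ENNReal.add_div]
        exact ENNReal.toReal_mono (ENNReal.div_ne_top (ENNReal.add_ne_top.2 ⟨hb _ _, hb _ _⟩)
          (hT0 k)) (ENNReal.div_le_div_right (h1 k g) _)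
      have h4 : a k g ≤ a k (g * h) + (b k g / T k).toReal := by
        rw [← ENNReal.toReal_add (hne _ _) (hne _ _), ← ENNReal.add_div]
        exact ENNReal.toReal_mono (ENNReal.div_ne_top (ENNReal.add_ne_top.2 ⟨hb _ _, hb _ _⟩)
          (hT0 k)) (ENNReal.div_le_div_right (h2 k g) _)
      exact abs_sub_le_iff.2 ⟨by linarith, by linarith⟩
    -- The radius is replaced by a positive one, as (P) requires: `R` need not be positive here.
    have hsum : ∀ k, ∑' g, b k g / T k ≤ N * (μ (hBoundary (2 * |R| + 1) (D k)) / μ (D k)) := by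
      intro k
      have hmono : μ (hBoundary (2 * R) (D k)) ≤ μ (hBoundary (2 * |R| + 1) (D k)) :=
        measure_mono (hBoundary_mono _ (by linarith [le_abs_self R]))
      simp only [div_eq_mul_inv]
      rw [ENNReal.tsum_mul_right, ← mul_assoc]
      gcongr
      · exact (tsum_measure_inter_smul_le hK hN _).trans (by gcongr)
      · exact hDT k
    have hlim' : Tendsto (fun k => N * (μ (hBoundary (2 * |R| + 1) (D k)) / μ (D k))) atTop
        (𝓝 0) := by
      have := ENNReal.Tendsto.const_mul (a := (N : ENNReal)) (hlim (2 * |R| + 1) (by positivity))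
        (Or.inr (ENNReal.natCast_ne_top N))
      rwa [mul_zero] at this
    have hlim'' := (ENNReal.tendsto_toReal ENNReal.zero_ne_top).comp hlim'
    rw [ENNReal.toReal_zero] at hlim''
    refine squeeze_zero' (Eventually.of_forall fun k => tsum_nonneg fun g => abs_nonneg _) ?_ hlim''
    filter_upwards [hlim'.eventually_lt_const ENNReal.zero_lt_top] with k hk
    have hfinsum : ∑' g, b k g / T k ≠ ⊤ := ne_top_of_le_ne_top hk.ne (hsum k)
    have hs := ENNReal.summable_toReal hfinsum
    calc ∑' g, |a k (g * h) - a k g| ≤ ∑' g, (b k g / T k).toReal :=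
          (Summable.of_nonneg_of_le (fun g => abs_nonneg _) (habs k) hs).tsum_le_tsum (habs k) hs
      _ = (∑' g, b k g / T k).toReal :=
          (ENNReal.tsum_toReal_eq fun g => ENNReal.div_ne_top (hb _ g) (hT0 k)).symm
      _ ≤ _ := ENNReal.toReal_mono hk.ne (hsum k)

/-- The translates of a compact set that meet sets with small boundary neighbourhoods form a
Følner sequence. -/
theorem tendsto_ncard_symmDiff_div_of_tendsto_measure_hBoundary [IsLocallyFiniteMeasure μ]
    [Countable G] (hX : HasShortConnections X) {K : Set X} (hK : IsCompact K) (hKne : K.Nonempty)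
    (hfin : {g : G | (g • K ∩ K).Nonempty}.Finite)
    (hcov : ∀ x : X, ∃ g : G, x ∈ g • K) {D : ℕ → Set X}
    (h0 : ∀ k, μ (D k) ≠ 0) (htop : ∀ k, μ (D k) ≠ ⊤)
    (hlim : ∀ d : ℝ, 0 < d → Tendsto (fun k => μ (hBoundary d (D k)) / μ (D k)) atTop (𝓝 0))
    {I : ℕ → Set G} (hI : ∀ k g, g ∈ I k ↔ (g • K ∩ D k).Nonempty) (hIf : ∀ k, (I k).Finite)
    (h : G) :
    Tendsto (fun k => ((I k ∆ (I k * {h})).ncard : ℝ) / ((I k).ncard : ℝ)) atTop (𝓝 0) := by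
  obtain ⟨N, hN⟩ := exists_encard_setOf_mem_smul_le hfin
  obtain ⟨R, hR⟩ : ∃ R : ℝ, ∀ y ∈ K ∪ h⁻¹ • K, ∀ z ∈ K ∪ h⁻¹ • K, dist y z < R := by
    obtain ⟨R, hR⟩ := Metric.isBounded_iff.1 (hK.union (hK.smul h⁻¹)).isBounded
    exact ⟨R + 1, fun y hy z hz => lt_of_le_of_lt (hR hy hz) (by linarith)⟩
  have hRpos : 0 < R := by
    obtain ⟨y, hy⟩ := hKne
    simpa using hR y (Or.inl hy) y (Or.inl hy)
  have hRg : ∀ g : G, ∀ y ∈ g • K ∪ (g * h⁻¹) • K, ∀ z ∈ g • K ∪ (g * h⁻¹) • K, dist y z < R := by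
    intro g y hy z hz
    rw [mul_smul, ← Set.smul_set_union] at hy hz
    obtain ⟨y', hy', rfl⟩ := hy
    obtain ⟨z', hz', rfl⟩ := hz
    rw [dist_smul]
    exact hR y' hy' z' hz'
  have hμK0 : μ K ≠ 0 := by
    intro hK0
    refine h0 0 (le_zero_iff.1 ((measure_le_tsum_inter_smul (μ := μ) hcov (D 0)).trans_eq ?_))
    refine ENNReal.tsum_eq_zero.2 fun g => measure_mono_null inter_subset_right ?_
    rw [measure_smul, hK0]
  have hμK : μ K ≠ ⊤ := hK.measure_lt_top.ne
  have hmulI : ∀ k g, g ∈ I k * {h} ↔ ((g * h⁻¹) • K ∩ D k).Nonempty := by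
    intro k g
    rw [← hI]
    constructor
    · rintro ⟨g', hg', _, rfl, rfl⟩
      simpa using hg'
    · exact fun hg => ⟨_, hg, h, rfl, by simp⟩
  -- Exactly one of `g • K` and `(g * h⁻¹) • K` meets `D k`, and their union has diameter at most
  -- `R`; so a point of `D k` and a point outside it lie close to all of `g • K`.
  have hsub : ∀ k, ∀ g ∈ I k ∆ (I k * {h}), g • K ⊆ hBoundary (2 * R) (D k) := by
    intro k g hg z hz
    obtain ⟨w, hw⟩ := hKne
    rcases hg with ⟨h1, h2⟩ | ⟨h1, h2⟩
    · obtain ⟨x, hxK, hxD⟩ := (hI k g).1 h1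
      have hwK : (g * h⁻¹) • w ∈ (g * h⁻¹) • K := Set.smul_mem_smul_set hw
      have hwD : (g * h⁻¹) • w ∉ D k := fun hwD => h2 ((hmulI k g).2 ⟨_, hwK, hwD⟩)
      exact hX.mem_hBoundary hxD hwD (hRg g _ (Or.inl hxK) _ (Or.inr hwK))
        (hRg g _ (Or.inl hz) _ (Or.inl hxK))
    · obtain ⟨x, hxK, hxD⟩ := (hmulI k g).1 h1
      have hzD : z ∉ D k := fun hzD => h2 ((hI k g).2 ⟨z, hz, hzD⟩)
      exact hX.mem_hBoundary hxD hzD (hRg g _ (Or.inr hxK) _ (Or.inl hz))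
        (hRg g _ (Or.inl hz) _ (Or.inr hxK))
  have hSf : ∀ k, (I k ∆ (I k * {h})).Finite := fun k =>
    ((hIf k).union ((hIf k).mul (finite_singleton h))).subset symmDiff_subset_union
  have hupper : ∀ k, ((I k ∆ (I k * {h})).ncard : ENNReal) * μ K ≤
      N * μ (hBoundary (2 * R) (D k)) := by
    intro k
    calc ((I k ∆ (I k * {h})).ncard : ENNReal) * μ K
        = ∑ g ∈ (hSf k).toFinset, μ (hBoundary (2 * R) (D k) ∩ g • K) := by
          rw [Set.ncard_eq_toFinset_card _ (hSf k), ← nsmul_eq_mul, ← Finset.sum_const]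
          refine Finset.sum_congr rfl fun g hg => ?_
          rw [inter_eq_self_of_subset_right (hsub k g ((hSf k).mem_toFinset.1 hg)), measure_smul]
      _ ≤ ∑' g, μ (hBoundary (2 * R) (D k) ∩ g • K) := ENNReal.sum_le_tsum _
      _ ≤ _ := tsum_measure_inter_smul_le hK hN _
  have hlower : ∀ k, μ (D k) ≤ (I k).ncard * μ K := by
    intro k
    calc μ (D k) ≤ μ (⋃ g ∈ (hIf k).toFinset, g • K) := by
          refine measure_mono fun x hx => ?_
          obtain ⟨g, hg⟩ := hcov x
          exact mem_iUnion₂.2 ⟨g, (hIf k).mem_toFinset.2 ((hI k g).2 ⟨x, hg, hx⟩), hg⟩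
      _ ≤ ∑ g ∈ (hIf k).toFinset, μ (g • K) := measure_biUnion_finset_le _ _
      _ = (I k).ncard * μ K := by
          simp_rw [measure_smul]
          rw [Finset.sum_const, nsmul_eq_mul, Set.ncard_eq_toFinset_card _ (hIf k)]
  have hratio : ∀ k, ((I k ∆ (I k * {h})).ncard : ENNReal) / (I k).ncard ≤
      N * (μ (hBoundary (2 * R) (D k)) / μ (D k)) := by
    intro k
    have hIk : ((I k).ncard : ENNReal) ≠ 0 := by
      intro hz
      refine h0 k (le_zero_iff.1 ((hlower k).trans_eq ?_))
      rw [hz, zero_mul]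
    rw [← mul_div_assoc, ENNReal.div_le_iff hIk (ENNReal.natCast_ne_top _), div_eq_mul_inv,
      mul_right_comm, ← div_eq_mul_inv, ENNReal.le_div_iff_mul_le (Or.inl (h0 k)) (Or.inl (htop k))]
    calc ((I k ∆ (I k * {h})).ncard : ENNReal) * μ (D k)
        ≤ (I k ∆ (I k * {h})).ncard * ((I k).ncard * μ K) := by gcongr; exact hlower k
      _ = ((I k ∆ (I k * {h})).ncard * μ K) * (I k).ncard := by ring
      _ ≤ _ := mul_le_mul' (hupper k) le_rfl
  have hlim' : Tendsto (fun k => N * (μ (hBoundary (2 * R) (D k)) / μ (D k))) atTop (𝓝 0) := by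
    have := ENNReal.Tendsto.const_mul (a := (N : ENNReal)) (hlim (2 * R) (by positivity))
      (Or.inr (ENNReal.natCast_ne_top N))
    rwa [mul_zero] at this
  have hE := tendsto_of_tendsto_of_tendsto_of_le_of_le tendsto_const_nhds hlim'
    (fun k => zero_le) hratio
  have hE' := (ENNReal.tendsto_toReal ENNReal.zero_ne_top).comp hE
  simpa [Function.comp_def, ENNReal.toReal_div] using hE'

/-- Amenability yields sets with small boundary neighbourhoods that contain a given compact set;
they can be taken from any class of sets that is fine enough. -/
theorem IsAmenableGroup.exists_measure_hBoundary_le [ProperSpace X] [IsLocallyFiniteMeasure μ]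
    [Countable G] (hG : IsAmenableGroup G) {K : Set X} (hK : IsCompact K) (hKne : K.Nonempty)
    (hfin : ∀ L : Set X, IsCompact L → {g : G | (g • K ∩ L).Nonempty}.Finite)
    (hcov : ∀ x : X, ∃ g : G, x ∈ g • K) {Reg : Set X → Prop} (hopen : ∀ D, Reg D → IsOpen D)
    (hReg : ∀ A B : Set X, IsCompact A → A.Nonempty → IsOpen B → A ⊆ B →
      ∃ D, Reg D ∧ A ⊆ D ∧ closure D ⊆ B)
    {C : Set X} (hC : IsCompact C) {d ε : ℝ} (hd : 0 ≤ d) (hε : 0 < ε) :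
    ∃ D, Reg D ∧ C ⊆ D ∧ IsCompact (closure D) ∧
      μ (hBoundary d D) ≤ ENNReal.ofReal ε * μ D := by
  classical
  obtain ⟨N, hN⟩ := exists_encard_setOf_mem_smul_le (hfin K hK)
  have hSfin : ∀ r, {g : G | (g • K ∩ Metric.cthickening r K).Nonempty}.Finite := fun r =>
    hfin _ hK.cthickening
  -- Differences `h⁻¹ * g` of translates of `K` that come within `r` of each other.
  let S : ℝ → Finset G := fun r => (hSfin r).toFinset
  have hS : ∀ r, 0 ≤ r → ∀ (g h : G) (x z : X), x ∈ g • K → z ∈ h • K → dist x z ≤ r →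
      h⁻¹ * g ∈ S r := by
    intro r hr g h x z hx hz hxz
    refine (hSfin r).mem_toFinset.2 ⟨h⁻¹ • x, ?_, ?_⟩
    · rw [mul_smul]
      exact Set.smul_mem_smul_set hx
    · refine Metric.mem_cthickening_of_dist_le _ (h⁻¹ • z) _ _
        (Set.mem_smul_set_iff_inv_smul_mem.1 hz) ?_
      rwa [dist_smul]
  let B := (hfin C hC).toFinset
  -- Pays for the passage from frontier translates to `d`-boundary translates, a factor `(S (d +
  -- 1)).card`, and for the multiplicity `N`; the `+ 1` avoids division by zero.
  let δ : ℝ := ε / ((S (d + 1)).card * N + 1)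
  have hδ : 0 < δ := by positivity
  obtain ⟨I, hIne, hBI, hI⟩ := hG.exists_finset_superset B (S 1) hδ
  let A : Set X := ⋃ g ∈ I, g • K
  have hA : IsCompact A := I.isCompact_biUnion fun g _ => hK.smul g
  have hAne : A.Nonempty := by
    obtain ⟨g, hg⟩ := hIne
    obtain ⟨x, hx⟩ := hKne
    exact ⟨g • x, mem_iUnion₂.2 ⟨g, hg, Set.smul_mem_smul_set hx⟩⟩
  have hCA : C ⊆ A := by
    intro x hx
    obtain ⟨g, hg⟩ := hcov x
    exact mem_iUnion₂.2 ⟨g, hBI ((hfin C hC).mem_toFinset.2 ⟨x, hg, hx⟩), hg⟩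
  obtain ⟨D, hD, hAD, hDB⟩ := hReg A (Metric.thickening 1 A) hA hAne Metric.isOpen_thickening
    (Metric.self_subset_thickening one_pos A)
  refine ⟨D, hD, hCA.trans hAD, ?_, ?_⟩
  · exact hA.cthickening.of_isClosed_subset isClosed_closure
      (hDB.trans (Metric.thickening_subset_cthickening 1 A))
  -- The frontier of the open set `D` avoids `A ⊆ D` but stays within distance 1 of `A`.
  have hfront : ∀ z ∈ frontier D, ∀ g : G, z ∈ g • K → g ∈ (I * S 1) \ I := by
    intro z hz g hg
    have hzA : z ∉ A := fun h => hz.2 (by rw [(hopen D hD).interior_eq]; exact hAD h)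
    obtain ⟨y, hy, hzy⟩ := Metric.mem_thickening_iff.1 (hDB hz.1)
    obtain ⟨h, hh, hyh⟩ := mem_iUnion₂.1 hy
    refine Finset.mem_sdiff.2 ⟨?_, fun hgI => hzA (mem_iUnion₂.2 ⟨g, hgI, hg⟩)⟩
    exact Finset.mem_mul.2 ⟨h, hh, _, hS 1 zero_le_one g h z y hg hyh hzy.le, by simp⟩
  have hbd : hBoundary d D ⊆ ⋃ g ∈ ((I * S 1) \ I) * S (d + 1), g • K := by
    intro x hx
    have h1 : Metric.infEDist x (frontier D) < ENNReal.ofReal (d + 1) :=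
      lt_of_le_of_lt hx ((ENNReal.ofReal_lt_ofReal_iff (by linarith)).2 (by linarith))
    obtain ⟨z, hz, hxz⟩ := Metric.infEDist_lt_iff.1 h1
    rw [edist_dist, ENNReal.ofReal_lt_ofReal_iff (by linarith)] at hxz
    obtain ⟨g, hg⟩ := hcov z
    obtain ⟨g', hg'⟩ := hcov x
    refine mem_iUnion₂.2 ⟨g', Finset.mem_mul.2 ⟨g, hfront z hz g hg, _,
      hS (d + 1) (by linarith) g' g x z hg' hg hxz.le, by simp⟩, hg'⟩
  have hlow : (I.card : ENNReal) * μ K ≤ N * μ D := by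
    calc (I.card : ENNReal) * μ K = ∑ g ∈ I, μ (D ∩ g • K) := by
          rw [← nsmul_eq_mul, ← Finset.sum_const]
          refine Finset.sum_congr rfl fun g hg => ?_
          have : g • K ⊆ D := fun x hx => hAD (mem_iUnion₂.2 ⟨g, hg, hx⟩)
          rw [inter_eq_self_of_subset_right this, measure_smul]
      _ ≤ ∑' g, μ (D ∩ g • K) := ENNReal.sum_le_tsum _
      _ ≤ _ := tsum_measure_inter_smul_le hK hN _
  have hcard : (((((I * S 1) \ I) * S (d + 1)).card * N : ℝ)) ≤ ε * I.card := by
    have h1 : (((((I * S 1) \ I) * S (d + 1)).card : ℝ)) ≤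
        ((I * S 1) \ I).card * (S (d + 1)).card := by exact_mod_cast Finset.card_mul_le
    calc (((((I * S 1) \ I) * S (d + 1)).card * N : ℝ))
        ≤ (δ * I.card) * (S (d + 1)).card * N := by
          refine mul_le_mul_of_nonneg_right (h1.trans ?_) (by positivity)
          exact mul_le_mul_of_nonneg_right hI (by positivity)
      _ = δ * ((S (d + 1)).card * N) * I.card := by ring
      _ ≤ δ * ((S (d + 1)).card * N + 1) * I.card := by gcongr; linarith
      _ = ε * I.card := by
          simp only [δ]
          rw [div_mul_cancel₀ _ (by positivity)]
  rcases Nat.eq_zero_or_pos N with hN0 | hNpos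
  · obtain ⟨x, -⟩ := hKne
    obtain ⟨g, hg⟩ := hcov x
    have := hN x
    rw [hN0, Nat.cast_zero, nonpos_iff_eq_zero, Set.encard_eq_zero] at this
    exact absurd hg (Set.eq_empty_iff_forall_notMem.1 this g)
  have hcardE : ((((I * S 1) \ I) * S (d + 1)).card * N : ENNReal) ≤
      ENNReal.ofReal ε * I.card := by
    rw [← ENNReal.ofReal_natCast, ← ENNReal.ofReal_natCast N, ← ENNReal.ofReal_natCast I.card,
      ← ENNReal.ofReal_mul (by positivity), ← ENNReal.ofReal_mul hε.le]
    exact ENNReal.ofReal_le_ofReal hcard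
  have hNE : (N : ENNReal) ≠ 0 := by exact_mod_cast hNpos.ne'
  have hfinal : N * μ (hBoundary d D) ≤ N * (ENNReal.ofReal ε * μ D) := by
    calc N * μ (hBoundary d D)
        ≤ N * ((((I * S 1) \ I) * S (d + 1)).card * μ K) := by
          gcongr
          refine (measure_mono hbd).trans ((measure_biUnion_finset_le _ _).trans_eq ?_)
          simp_rw [measure_smul]
          rw [Finset.sum_const, nsmul_eq_mul]
      _ = ((((I * S 1) \ I) * S (d + 1)).card * N) * μ K := by ring
      _ ≤ (ENNReal.ofReal ε * I.card) * μ K := by gcongr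
      _ = ENNReal.ofReal ε * (I.card * μ K) := by ring
      _ ≤ ENNReal.ofReal ε * (N * μ D) := by gcongr
      _ = _ := by ring
  exact (ENNReal.mul_le_mul_iff_right hNE (ENNReal.natCast_ne_top N)).1 hfinal

end ProperActions

/-! ### Regular sets and polyhedral fundamental domains -/

section RegularAndPolyhedral

theorem IsRegularSet.isOpen {n : ℕ} {X : Type*} [TopologicalSpace X]
    [ChartedSpace (EuclideanSpace ℝ (Fin n)) X] {D : Set X} (hD : IsRegularSet n D) :
    IsOpen D := by
  obtain ⟨k, C, -, hC, -, rfl⟩ := hD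
  refine isOpen_iUnion fun i => ?_
  obtain ⟨-, K, -, -, -, h⟩ := hC i
  rw [h]
  exact isOpen_interior

theorem IsRegularSet.nonempty {n : ℕ} {X : Type*} [TopologicalSpace X]
    [ChartedSpace (EuclideanSpace ℝ (Fin n)) X] {D : Set X} (hD : IsRegularSet n D) :
    D.Nonempty := by
  obtain ⟨k, C, hk, hC, -, rfl⟩ := hD
  obtain ⟨x, hx⟩ := (hC ⟨0, hk⟩).1
  exact ⟨x, mem_iUnion.2 ⟨_, hx⟩⟩

theorem IsRegularSet.exists_isCompact_superset {n : ℕ} {X : Type*} [TopologicalSpace X]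
    [ChartedSpace (EuclideanSpace ℝ (Fin n)) X] {D : Set X} (hD : IsRegularSet n D) :
    ∃ L, IsCompact L ∧ D ⊆ L := by
  obtain ⟨k, C, -, hC, -, rfl⟩ := hD
  choose hne K hK using hC
  exact ⟨⋃ i, K i, isCompact_iUnion fun i => (hK i).2.1,
    iUnion_mono fun i => (hK i).2.2.2 ▸ interior_subset⟩

theorem IsSmoothSimplex.isCompact {n : ℕ} {X : Type*} [TopologicalSpace X]
    [ChartedSpace (EuclideanSpace ℝ (Fin n)) X] {S : Set X} (hS : IsSmoothSimplex n S) :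
    IsCompact S := by
  obtain ⟨v, f, U, -, -, hU, hf, -, -, rfl⟩ := hS
  exact ((Set.finite_range v).isCompact_convexHull ℝ).image_of_continuousOn (hf.continuousOn.mono hU)

theorem IsPolyhedralFundamentalDomain.isCompact {n : ℕ} {X M : Type*} [TopologicalSpace X]
    [ChartedSpace (EuclideanSpace ℝ (Fin n)) X] {p : X → M} {F : Set X}
    (hF : IsPolyhedralFundamentalDomain n p F) : IsCompact F := by
  obtain ⟨k, S, hS, -, rfl⟩ := hF.exists_simplices
  exact isCompact_iUnion fun i => (hS i).isCompact

theorem IsPolyhedralFundamentalDomain.exists_mem_smul {n : ℕ} {X M : Type*} [TopologicalSpace X]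
    [ChartedSpace (EuclideanSpace ℝ (Fin n)) X] {p : X → M} {F : Set X}
    (hF : IsPolyhedralFundamentalDomain n p F) (x : X) : ∃ γ : deckGroup p, x ∈ γ • F := by
  have hx : x ∈ ⋃ γ : deckGroup p, (γ : X ≃ₜ X) '' F := by rw [hF.covers]; exact mem_univ x
  exact mem_iUnion.1 hx

/-- The translates of a compact set that meet a set `D` approximate `D`. -/
theorem symmDiff_translatesInterior_subset_hBoundary {X M : Type*} [MetricSpace X] {p : X → M}
    [IsIsometricSMul (deckGroup p) X] (hX : HasShortConnections X) {F : Set X} (hF : IsCompact F)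
    (hcov : ∀ x : X, ∃ γ : deckGroup p, x ∈ γ • F) {R : ℝ}
    (hR : ∀ x ∈ F, ∀ y ∈ F, dist x y < R) {D : Set X} (hD : IsOpen D) {I : Set (deckGroup p)}
    (hI : ∀ γ, γ ∈ I ↔ (γ • F ∩ D).Nonempty) (hIf : I.Finite) :
    D ∆ translatesInterior p F I ⊆ hBoundary (2 * R) D := by
  have hcl : IsClosed (⋃ γ ∈ I, γ • F) := (hIf.isCompact_biUnion fun γ _ => hF.smul γ).isClosed
  have hU : translatesInterior p F I = interior (⋃ γ ∈ I, γ • F) := by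
    change interior (closure (⋃ γ ∈ I, γ • F)) = _
    rw [hcl.closure_eq]
  rw [hU]
  rintro x (⟨hx, hx'⟩ | ⟨hx, hx'⟩)
  · refine absurd (interior_maximal (fun y hy => ?_) hD hx) hx'
    obtain ⟨γ, hγ⟩ := hcov y
    exact mem_iUnion₂.2 ⟨γ, (hI γ).2 ⟨y, hγ, hy⟩, hγ⟩
  · obtain ⟨γ, hγ, hxγ⟩ := mem_iUnion₂.1 (interior_subset hx)
    obtain ⟨y, ⟨y', hy', rfl⟩, hyD⟩ := (hI γ).1 hγ
    obtain ⟨x', hx'F, rfl⟩ := hxγ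
    have h1 : ∀ a ∈ F, ∀ b ∈ F, dist (γ • a) (γ • b) < R := fun a ha b hb => by
      rw [dist_smul]
      exact hR a ha b hb
    exact hX.mem_hBoundary hyD hx' (h1 _ hy' _ hx'F) (h1 _ hx'F _ hy')

end RegularAndPolyhedral

/-! ### Sequences with property (P) and the main result -/

theorem HasPropertyP.comp {n : ℕ} {X : Type*} [MetricSpace X] [MeasurableSpace X] [BorelSpace X]
    {D : ℕ → Set X} (hD : HasPropertyP n D) {j : ℕ → ℕ} (hj : StrictMono j) :
    HasPropertyP n (D ∘ j) where
  measurableSet _ := hD.measurableSet _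
  volume_ne_zero _ := hD.volume_ne_zero _
  volume_ne_top _ := hD.volume_ne_top _
  tendsto d hd := (hD.tendsto d hd).comp hj.tendsto_atTop

theorem smulInvariantMeasure_euclideanHausdorffMeasure (n : ℕ) (G X : Type*) [Group G]
    [MetricSpace X] [MeasurableSpace X] [BorelSpace X] [MulAction G X] [IsIsometricSMul G X] :
    SMulInvariantMeasure G X (μHE[n] : Measure X) :=
  ⟨fun g _ hs => ((IsometryEquiv.constSMul g).measurePreserving_euclideanHausdorffMeasure n).measure_preimage
    hs.nullMeasurableSet⟩

/-- Sequences of ever larger sets with ever smaller boundary neighbourhoods have property (P). -/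
theorem exists_monotone_hasPropertyP {n : ℕ} {X : Type*} [MetricSpace X] [MeasurableSpace X]
    [BorelSpace X] [IsLocallyFiniteMeasure (μHE[n] : Measure X)]
    [(μHE[n] : Measure X).IsOpenPosMeasure] {Reg : Set X → Prop} (hopen : ∀ D, Reg D → IsOpen D)
    (hne : ∀ D, Reg D → D.Nonempty)
    (h : ∀ (d ε : ℝ) (C : Set X), 0 ≤ d → 0 < ε → IsCompact C → ∃ D, Reg D ∧ C ⊆ D ∧
      IsCompact (closure D) ∧
      (μHE[n] : Measure X) (hBoundary d D) ≤ ENNReal.ofReal ε * (μHE[n] : Measure X) D) :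
    ∃ D : ℕ → Set X, Monotone D ∧ (∀ k, Reg (D k)) ∧ HasPropertyP n D := by
  have h' : ∀ (k : ℕ) (C : TopologicalSpace.Compacts X), ∃ D, Reg D ∧ (C : Set X) ⊆ D ∧
      IsCompact (closure D) ∧ (μHE[n] : Measure X) (hBoundary k D) ≤
        ENNReal.ofReal (1 / (k + 1)) * (μHE[n] : Measure X) D := fun k C =>
    h k (1 / (k + 1)) C (by positivity) (by positivity) C.isCompact
  choose f hf1 hf2 hf3 hf4 using h'
  -- Recursion on compact sets: each new set contains the closure of its predecessor, and its
  -- `k`-boundary has relative volume at most `1 / (k + 1)`.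
  let s : ℕ → TopologicalSpace.Compacts X :=
    fun k => Nat.rec ⊥ (fun k C => ⟨closure (f k C), hf3 k C⟩) k
  let D : ℕ → Set X := fun k => f k (s k)
  have hDs : ∀ k, D k ⊆ s (k + 1) := fun k => subset_closure
  have hfin : ∀ k, (μHE[n] : Measure X) (D k) ≠ ⊤ := fun k =>
    ne_top_of_le_ne_top (hf3 k (s k)).measure_lt_top.ne (measure_mono subset_closure)
  have h0 : ∀ k, (μHE[n] : Measure X) (D k) ≠ 0 := fun k =>
    ((hopen _ (hf1 k (s k))).measure_pos _ (hne _ (hf1 k (s k)))).ne'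
  refine ⟨D, monotone_nat_of_le_succ fun k => (hDs k).trans (hf2 (k + 1) (s (k + 1))),
    fun k => hf1 k (s k), fun k => (hopen _ (hf1 k (s k))).measurableSet, h0, hfin, fun d hd => ?_⟩
  have hlim : Tendsto (fun k : ℕ => ENNReal.ofReal (1 / (k + 1))) atTop (𝓝 0) := by
    rw [← ENNReal.ofReal_zero]
    exact ENNReal.tendsto_ofReal tendsto_one_div_add_atTop_nhds_zero_nat
  refine tendsto_of_tendsto_of_tendsto_of_le_of_le' tendsto_const_nhds hlim
    (Eventually.of_forall fun k => zero_le) ?_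
  filter_upwards [eventually_ge_atTop ⌈d⌉₊] with k hk
  rw [ENNReal.div_le_iff (h0 k) (hfin k)]
  exact (measure_mono (hBoundary_mono _ (Nat.ceil_le.1 hk))).trans (hf4 k (s k))

theorem proposition1p3 (n : ℕ)
    {X : Type*} [MetricSpace X] [MeasurableSpace X] [BorelSpace X]
    [ChartedSpace (EuclideanSpace ℝ (Fin n)) X] [IsManifold (𝓡 n) ∞ X]
    [Bundle.RiemannianBundle (fun x : X => TangentSpace (𝓡 n) x)]
    [IsContMDiffRiemannianBundle (𝓡 n) ∞ (EuclideanSpace ℝ (Fin n))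
      (fun x : X => TangentSpace (𝓡 n) x)]
    [IsRiemannianManifold (𝓡 n) X] [SimplyConnectedSpace X]
    {M : Type*} [TopologicalSpace M] [T2Space M] [CompactSpace M]
    [ChartedSpace (EuclideanSpace ℝ (Fin n)) M] [IsManifold (𝓡 n) ∞ M]
    [Bundle.RiemannianBundle (fun x : M => TangentSpace (𝓡 n) x)]
    [IsContMDiffRiemannianBundle (𝓡 n) ∞ (EuclideanSpace ℝ (Fin n))
      (fun x : M => TangentSpace (𝓡 n) x)]
    (p : X → M) (hp : IsRiemannianCovering n p) :
    (∀ F : Set X, IsPolyhedralFundamentalDomain n p F →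
      ∀ D : ℕ → Set X, Monotone D → (∀ k, IsRegularSet n (D k)) → HasPropertyP n D →
        ∃ j : ℕ → ℕ, StrictMono j ∧ IsAdmissibleSequence n p F (D ∘ j)) ∧
    ((∃ D : ℕ → Set X, HasPropertyP n D) ↔ IsAmenableGroup (deckGroup p)) ∧
    ((∃ D : ℕ → Set X, Monotone D ∧ (∀ k, IsRegularSet n (D k)) ∧ HasPropertyP n D) ↔
      IsAmenableGroup (deckGroup p)) := by
  have hX : HasShortConnections X := hasShortConnections_of_isRiemannianManifold n X
  have hcovering := hp.isCoveringMap
  have : LocallyPathConnectedSpace X :=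
    ChartedSpace.locallyPathConnectedSpace (EuclideanSpace ℝ (Fin n)) X
  have : LocallyCompactSpace X := ChartedSpace.locallyCompactSpace (EuclideanSpace ℝ (Fin n)) X
  have : IsIsometricSMul (deckGroup p) X := hp.isIsometricSMul
  obtain ⟨K, hK, hpK⟩ := hcovering.exists_isCompact_image_eq_univ hp.surjective
  have hcov : ∀ x : X, ∃ γ : deckGroup p, x ∈ γ • K := by
    intro x
    obtain ⟨y, hy, hyx⟩ : p x ∈ p '' K := by rw [hpK]; exact mem_univ _
    obtain ⟨γ, hγ⟩ := hcovering.exists_deckGroup_smul_eq hyx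
    exact ⟨γ, y, hy, hγ⟩
  have hKne : K.Nonempty := by
    obtain ⟨x⟩ : Nonempty X := inferInstance
    obtain ⟨γ, y, hy, -⟩ := hcov x
    exact ⟨y, hy⟩
  have : ProperSpace X := by
    -- Balls of radius `δ` about points of `K` are compact, and by isometric translation so are all
    -- balls of that radius; the length structure then gives properness.
    obtain ⟨δ, hδ, hc⟩ := hK.exists_isCompact_cthickening
    refine hX.properSpace hδ fun x => ?_
    obtain ⟨γ, y, hy, rfl⟩ := hcov x
    rw [← Metric.smul_closedBall]
    exact (hc.of_isClosed_subset Metric.isClosed_closedBall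
      (Metric.closedBall_subset_cthickening hy δ)).smul γ
  have hfin : ∀ K L : Set X, IsCompact K → IsCompact L →
      {γ : deckGroup p | (γ • K ∩ L).Nonempty}.Finite := fun K L hK hL =>
    hcovering.finite_setOf_smul_inter_nonempty hK hL
  have : Countable (deckGroup p) := countable_of_proper hKne fun L hL => hfin K L hK hL
  have : IsLocallyFiniteMeasure (μHE[n] : Measure X) := isLocallyFiniteMeasure_riemannianVolume
  have : (μHE[n] : Measure X).IsOpenPosMeasure := isOpenPosMeasure_riemannianVolume
  have : SMulInvariantMeasure (deckGroup p) X (μHE[n] : Measure X) :=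
    smulInvariantMeasure_euclideanHausdorffMeasure n _ X
  have hmean : ∀ D : ℕ → Set X, HasPropertyP n D → IsAmenableGroup (deckGroup p) := fun D hD =>
    isAmenableGroup_of_tendsto_measure_hBoundary hX hK (hfin K K hK hK) hcov hD.volume_ne_zero
      hD.volume_ne_top hD.tendsto
  have hexists : IsAmenableGroup (deckGroup p) →
      ∃ D : ℕ → Set X, Monotone D ∧ (∀ k, IsRegularSet n (D k)) ∧ HasPropertyP n D := fun hG =>
    exists_monotone_hasPropertyP (fun D hD => hD.isOpen) (fun D hD => hD.nonempty)
      fun d ε C hd hε hC => hG.exists_measure_hBoundary_le hK hKne (fun L hL => hfin K L hK hL) hcov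
        (fun D hD => hD.isOpen)
        (fun A B hA hAne hB hAB => exists_isRegularSet_between hA hAne hB hAB) hC hd hε
  refine ⟨fun F hF D hmono hreg hD => ?_, ⟨fun ⟨D, hD⟩ => hmean D hD, fun hG => ?_⟩,
    ⟨fun ⟨D, _, _, hD⟩ => hmean D hD, hexists⟩⟩
  · have hFc := hF.isCompact
    -- Monotone because `D` is, and a Følner sequence by property (P); temperedness is the only
    -- reason to pass to a subsequence.
    let I : ℕ → Set (deckGroup p) := fun k => {γ | (γ • F ∩ D k).Nonempty}
    have hIf : ∀ k, (I k).Finite := by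
      intro k
      obtain ⟨L, hL, hDL⟩ := (hreg k).exists_isCompact_superset
      exact (hfin F L hFc hL).subset fun γ hγ => hγ.mono (inter_subset_inter_right _ hDL)
    have hIne : ∀ k, (I k).Nonempty := by
      intro k
      obtain ⟨x, hx⟩ := (hreg k).nonempty
      obtain ⟨γ, hγ⟩ := hF.exists_mem_smul x
      exact ⟨γ, x, hγ, hx⟩
    have hImono : Monotone I := fun k l hkl γ hγ =>
      hγ.mono (inter_subset_inter_right _ (hmono hkl))
    have hfol := fun γ => tendsto_ncard_symmDiff_div_of_tendsto_measure_hBoundary hX hFc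
      hF.isConnected.nonempty (hfin F F hFc hFc) hF.exists_mem_smul hD.volume_ne_zero
      hD.volume_ne_top hD.tendsto (I := I) (fun k γ => Iff.rfl) hIf γ
    obtain ⟨j, hj, hIj⟩ := exists_isTemperedFolner_comp hImono hIne hIf hfol
    obtain ⟨R, hR⟩ := Metric.isBounded_iff.1 hFc.isBounded
    have hR' : ∀ x ∈ F, ∀ y ∈ F, dist x y < |R| + 1 := fun x hx y hy =>
      lt_of_le_of_lt (hR hx hy) (by linarith [le_abs_self R])
    refine ⟨j, hj, fun k => hreg _, I ∘ j, hIj, Or.inl ⟨⟨fun k => isOpen_interior,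
      fun k => (hreg _).isOpen, 2 * (|R| + 1), by positivity, fun k => ?_⟩, hD.comp hj⟩⟩
    exact symmDiff_translatesInterior_subset_hBoundary hX hFc hF.exists_mem_smul hR'
      (hreg _).isOpen (fun γ => Iff.rfl) (hIf _)
  · obtain ⟨D, -, -, hD⟩ := hexists hG
    exact ⟨D, hD⟩
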